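/- **Definitions.** Let $H_2(p)=-p\log_2 p-(1-p)\log_2(1-p)$ be the binary entropy function, let $H_2^{-1}:[0,1]\to[0,1/2]$ be the inverse of its restriction to $[0,1/2]$, and let $$\kappa_Z(\delta)=\sup_{0<\kappa<1-H_2(\delta)}\kappa\left(1-\frac{\delta}{H_2^{-1}(1-\kappa)}\right)$$ be the rate given by the Zyablov bound (the supremum of the empty set, which occurs for $\delta=1/2$, is $0$). A binary $(m,K,d)$-code is a set $C\subseteq\{0,1\}^m$ of $K$ words with pairwise Hamming distances at least $d$; it meets the Gilbert–Varshamov bound if $\frac1m\log_2K\ge 1-H_2(d/m)$. A unique decoder for $C$ maps every word at distance at most $\lfloor (d-1)/2\rfloor$ from a codeword to that codeword (and every other word to an arbitrary word). Algorithms are programs of a random access machine with logarithmic cost that can draw independent fair random bits; a call of a black box on a word of length $m$ costs $m+1$. **Theorem.** Let $m\ge1$, let $x_0,\dots,x_{n-1}\in\{0,1\}^m$ be $n$ binary vectors such that exactly one pair of indices $\{i,j\}$, $i\ne j$ (not known to the algorithm), achieves the minimum pairwise Hamming distance $d_{\min}$; the second smallest distance may be as small as $d_{\min}+1$. Suppose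 that the value of $d_{\min}$ is given, and let $\delta:=d_{\min}/m$. 1. There is a randomized algorithm that, for every such input, runs in time $O\big(n\log^2 n\cdot 2^{(1-\kappa_Z(\delta)-\delta)m}\cdot\mathrm{poly}(m)\big)$ for every outcome of its random bits, and finds the closest pair $\{i,j\}$ with probability at least $1-1/n^2$. 2. There is a randomized algorithm that, for every such input, and given as a black box a unique decoder for some binary $(m,K,d_{\min}+1)$-code that meets the Gilbert–Varshamov bound, runs in time $O\big(n\log^2 n\cdot 2^{(H_2(\delta)-\delta)m}\cdot\mathrm{poly}(m)\big)$ for every outcome of its random bits, and finds the closest pair $\{i,j\}$ with probability at least $1-1/n^2$. In each part the algorithm, the constant and the polynomial do not depend on the input, i.e. not on $n$, $m$, $d_{\min}$, the vectors, the code or the decoder. -/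

import Mathlib

/-! ### Entropy, the Zyablov rate, and binary codes -/

/-- Binary words of length `m`, i.e. the elements of `{0,1}^m`. -/
abbrev BinWord (m : ℕ) : Type := Fin m → Bool

/-- The binary entropy function in bits: `H₂(p) = -p log₂ p - (1 - p) log₂ (1 - p)`. -/
noncomputable def entropy2 (p : ℝ) : ℝ := Real.binEntropy p / Real.log 2

/-- The inverse `H₂⁻¹ : [0,1] → [0,1/2]` of the restriction of `H₂` to `[0,1/2]`. -/
noncomputable def entropy2Inv (y : ℝ) : ℝ :=
  Function.invFunOn entropy2 (Set.Icc (0 : ℝ) (1 / 2)) y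

/-- The rate given by the Zyablov bound at relative distance `δ`:
the supremum of `κ (1 - δ / H₂⁻¹(1 - κ))` over the inner rates `0 < κ < 1 - H₂(δ)`.
It is `1` at `δ = 0`, and `0` for `1/2 ≤ δ ≤ 1`. -/
noncomputable def zyablovRate (δ : ℝ) : ℝ :=
  sSup ((fun κ : ℝ => κ * (1 - δ / entropy2Inv (1 - κ))) '' Set.Ioo 0 (1 - entropy2 δ))

/-- Any two distinct codewords of `C` are at Hamming distance at least `d`:
`C` is an `(m, |C|, d)`-code. -/
def HasMinDist {m : ℕ} (C : Finset (BinWord m)) (d : ℕ) : Prop :=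
  ∀ c ∈ C, ∀ c' ∈ C, c ≠ c' → d ≤ hammingDist c c'

/-- The `(m, |C|, d)`-code `C` meets the Gilbert-Varshamov bound: its rate `log₂ |C| / m` is at
least `1 - H₂(d/m)`. -/
def MeetsGV {m : ℕ} (C : Finset (BinWord m)) (d : ℕ) : Prop :=
  (2 : ℝ) ^ ((1 - entropy2 ((d : ℝ) / m)) * m) ≤ (C.card : ℝ)

/-- `D` is a unique decoder for the `(m, |C|, d)`-code `C`: a word within the decoding radius
`⌊(d - 1) / 2⌋` of a codeword is mapped to that codeword. Nothing is required of other words. -/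
def IsUniqueDecoder {m : ℕ} (C : Finset (BinWord m)) (d : ℕ) (D : BinWord m → BinWord m) : Prop :=
  ∀ x : BinWord m, ∀ c ∈ C, hammingDist x c ≤ (d - 1) / 2 → D x = c

/-- `{x i, x j}` is the unique closest pair among the words `x 0, …, x (n - 1)`, and `d` is its
distance. -/
def IsUniqueClosestPair {n m : ℕ} (x : Fin n → BinWord m) (i j : Fin n) (d : ℕ) : Prop :=
  i ≠ j ∧ hammingDist (x i) (x j) = d ∧
    ∀ a b : Fin n, a ≠ b → s(a, b) ≠ s(i, j) → d < hammingDist (x a) (x b)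

/-! ### Randomized random access machines with logarithmic cost

A program works on registers and on arrays, all holding natural numbers. Registers and arrays are
named by fixed numbers that occur in the program; array indices are computed. Every evaluation of
a subexpression costs one plus the bit length of its value. -/

namespace RAM

/-- The memory, and the part of the random tape that has not been read yet. -/
structure State where
  reg : ℕ → ℕ
  arr : ℕ → ℕ → ℕ
  tape : ℕ → Bool

/-- Expressions. -/
inductive Exp where
  | lit (k : ℕ)
  | var (r : ℕ)
  | get (a : ℕ) (e : Exp)
  | add (e₁ e₂ : Exp)
  | sub (e₁ e₂ : Exp)
  | mul (e₁ e₂ : Exp)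
  | div (e₁ e₂ : Exp)
  | lt (e₁ e₂ : Exp)
  | eq (e₁ e₂ : Exp)

/-- The value of an expression; subtraction is truncated, division is rounded down, and the
comparisons return `0` or `1`. -/
def Exp.eval (s : State) : Exp → ℕ
  | .lit k => k
  | .var r => s.reg r
  | .get a e => s.arr a (e.eval s)
  | .add e₁ e₂ => e₁.eval s + e₂.eval s
  | .sub e₁ e₂ => e₁.eval s - e₂.eval s
  | .mul e₁ e₂ => e₁.eval s * e₂.eval s
  | .div e₁ e₂ => e₁.eval s / e₂.eval s
  | .lt e₁ e₂ => if e₁.eval s < e₂.eval s then 1 else 0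
  | .eq e₁ e₂ => if e₁.eval s = e₂.eval s then 1 else 0

/-- The logarithmic cost of evaluating an expression: every node costs one plus the bit length of
its value. -/
def Exp.cost (s : State) : Exp → ℕ
  | .lit k => 1 + Nat.size k
  | .var r => 1 + Nat.size (s.reg r)
  | .get a e => 1 + Nat.size ((Exp.get a e).eval s) + e.cost s
  | .add e₁ e₂ => 1 + Nat.size ((Exp.add e₁ e₂).eval s) + e₁.cost s + e₂.cost s
  | .sub e₁ e₂ => 1 + Nat.size ((Exp.sub e₁ e₂).eval s) + e₁.cost s + e₂.cost s
  | .mul e₁ e₂ => 1 + Nat.size ((Exp.mul e₁ e₂).eval s) + e₁.cost s + e₂.cost s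
  | .div e₁ e₂ => 1 + Nat.size ((Exp.div e₁ e₂).eval s) + e₁.cost s + e₂.cost s
  | .lt e₁ e₂ => 1 + Nat.size ((Exp.lt e₁ e₂).eval s) + e₁.cost s + e₂.cost s
  | .eq e₁ e₂ => 1 + Nat.size ((Exp.eq e₁ e₂).eval s) + e₁.cost s + e₂.cost s

/-- Programs. `store a e₁ e₂` writes the value of `e₂` into cell `e₁` of array `a`, `flip r` puts a
fresh random bit into register `r`, and `decode a b` hands the first `m` cells of array `a` to the
black-box decoder and puts its answer into the first `m` cells of array `b`. Guards of `ite` and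
`loop` (a while loop) count as true if their value is not `0`. -/
inductive Prog where
  | skip
  | assign (r : ℕ) (e : Exp)
  | store (a : ℕ) (e₁ e₂ : Exp)
  | flip (r : ℕ)
  | decode (a b : ℕ)
  | seq (p q : Prog)
  | ite (e : Exp) (p q : Prog)
  | loop (e : Exp) (p : Prog)

/-- The state after `r := v`. -/
def State.setReg (s : State) (r v : ℕ) : State :=
  { s with reg := Function.update s.reg r v }

/-- The state after cell `k` of array `a` has been set to `v`. -/
def State.setArr (s : State) (a k v : ℕ) : State :=
  { s with arr := Function.update s.arr a (Function.update (s.arr a) k v) }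

/-- The state after the next bit of the random tape has been moved to register `r`. -/
def State.flipInto (s : State) (r : ℕ) : State :=
  { s with
    reg := Function.update s.reg r (s.tape 0).toNat
    tape := fun k => s.tape (k + 1) }

/-- The word of length `m` in the first `m` cells of array `a` (nonzero cells are read as `1`). -/
def State.readWord (s : State) (m a : ℕ) : BinWord m := fun k => decide (s.arr a k ≠ 0)

/-- The state after the word `w` has been written to the first `m` cells of array `b`. -/
def State.writeWord {m : ℕ} (s : State) (b : ℕ) (w : BinWord m) : State :=
  { s with
    arr := Function.update s.arr b
      (fun k => if h : k < m then (w ⟨k, h⟩).toNat else s.arr b k) }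

/-- `Exec dec p s t s'`: started in state `s`, the program `p` halts after time `t` in state `s'`.
Here `dec` is the black-box decoder, if there is one; without it, a program that executes `decode`
is stuck and never halts. A call of the black box costs `m + 1`. -/
inductive Exec {m : ℕ} (dec : Option (BinWord m → BinWord m)) :
    Prog → State → ℕ → State → Prop where
  | skip (s : State) : Exec dec .skip s 1 s
  | assign (r : ℕ) (e : Exp) (s : State) :
      Exec dec (.assign r e) s (1 + e.cost s) (s.setReg r (e.eval s))
  | store (a : ℕ) (e₁ e₂ : Exp) (s : State) :
      Exec dec (.store a e₁ e₂) s (1 + e₁.cost s + e₂.cost s)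
        (s.setArr a (e₁.eval s) (e₂.eval s))
  | flip (r : ℕ) (s : State) : Exec dec (.flip r) s 1 (s.flipInto r)
  | decode (a b : ℕ) (s : State) (D : BinWord m → BinWord m) (hD : dec = some D) :
      Exec dec (.decode a b) s (m + 1) (s.writeWord b (D (s.readWord m a)))
  | seq {p q : Prog} {s s' s'' : State} {t t' : ℕ} (hp : Exec dec p s t s')
      (hq : Exec dec q s' t' s'') : Exec dec (.seq p q) s (t + t') s''
  | iteTrue {e : Exp} {p q : Prog} {s s' : State} {t : ℕ} (he : e.eval s ≠ 0)
      (hp : Exec dec p s t s') : Exec dec (.ite e p q) s (1 + e.cost s + t) s'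
  | iteFalse {e : Exp} {p q : Prog} {s s' : State} {t : ℕ} (he : e.eval s = 0)
      (hq : Exec dec q s t s') : Exec dec (.ite e p q) s (1 + e.cost s + t) s'
  | loopDone {e : Exp} {p : Prog} {s : State} (he : e.eval s = 0) :
      Exec dec (.loop e p) s (1 + e.cost s) s
  | loopStep {e : Exp} {p : Prog} {s s' s'' : State} {t t' : ℕ} (he : e.eval s ≠ 0)
      (hp : Exec dec p s t s') (hl : Exec dec (.loop e p) s' t' s'') :
      Exec dec (.loop e p) s (1 + e.cost s + t + t') s''

/-- Execution is deterministic, once the random tape is fixed. -/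
theorem Exec.deterministic {m : ℕ} {dec : Option (BinWord m → BinWord m)} {p : Prog}
    {s s₁ s₂ : State} {t₁ t₂ : ℕ} (h₁ : Exec dec p s t₁ s₁) (h₂ : Exec dec p s t₂ s₂) :
    t₁ = t₂ ∧ s₁ = s₂ := by
  induction h₁ generalizing t₂ s₂ with
  | skip s => cases h₂; exact ⟨rfl, rfl⟩
  | assign r e s => cases h₂; exact ⟨rfl, rfl⟩
  | store a e₁ e₂ s => cases h₂; exact ⟨rfl, rfl⟩
  | flip r s => cases h₂; exact ⟨rfl, rfl⟩
  | decode a b s D hD =>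
    cases h₂ with
    | decode _ _ _ D' hD' =>
      rw [hD] at hD'
      cases hD'
      exact ⟨rfl, rfl⟩
  | seq hp hq ihp ihq =>
    cases h₂ with
    | seq hp' hq' =>
      obtain ⟨rfl, rfl⟩ := ihp hp'
      obtain ⟨rfl, rfl⟩ := ihq hq'
      exact ⟨rfl, rfl⟩
  | iteTrue he hp ih =>
    cases h₂ with
    | iteTrue he' hp' =>
      obtain ⟨rfl, rfl⟩ := ih hp'
      exact ⟨rfl, rfl⟩
    | iteFalse he' hq' => exact absurd he' he
  | iteFalse he hq ih =>
    cases h₂ with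
    | iteTrue he' hp' => exact absurd he he'
    | iteFalse he' hq' =>
      obtain ⟨rfl, rfl⟩ := ih hq'
      exact ⟨rfl, rfl⟩
  | loopDone he =>
    cases h₂ with
    | loopDone he' => exact ⟨rfl, rfl⟩
    | loopStep he' hp' hl' => exact absurd he he'
  | loopStep he hp hl ihp ihl =>
    cases h₂ with
    | loopDone he' => exact absurd he' he
    | loopStep he' hp' hl' =>
      obtain ⟨rfl, rfl⟩ := ihp hp'
      obtain ⟨rfl, rfl⟩ := ihl hl'
      exact ⟨rfl, rfl⟩

/-- The initial state: `n`, `m` and `d` are in registers `0`, `1` and `2`, bit `k` of the word `x i`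
is in cell `i * m + k` of array `0`, everything else is `0`, and the random tape is `ω`. -/
def initState {n m : ℕ} (x : Fin n → BinWord m) (d : ℕ) (ω : ℕ → Bool) : State where
  reg r := if r = 0 then n else if r = 1 then m else if r = 2 then d else 0
  arr a c := if a = 0 then
      if h : c < n * m then
        (x (finProdFinEquiv.symm ⟨c, h⟩).1 (finProdFinEquiv.symm ⟨c, h⟩).2).toNat
      else 0
    else 0
  tape := ω

/-- The law of an infinite sequence of independent fair random bits. -/
noncomputable def fairBits : MeasureTheory.Measure (ℕ → Bool) :=
  MeasureTheory.Measure.infinitePi fun _ : ℕ => (PMF.uniformOfFintype Bool).toMeasure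

/-- On the words `x` and the number `d`, the program `p` halts within time `T` for every outcome of
its random bits, and with probability at least `1 - 1 / n ^ 2` it leaves the indices `i` and `j`, in
some order, in registers `0` and `1`. -/
def FindsPair {n m : ℕ} (p : Prog) (dec : Option (BinWord m → BinWord m)) (x : Fin n → BinWord m)
    (d : ℕ) (i j : Fin n) (T : ℝ) : Prop :=
  (∀ ω : ℕ → Bool, ∃ (t : ℕ) (f : State), Exec dec p (initState x d ω) t f ∧ (t : ℝ) ≤ T) ∧
    1 - 1 / (n : ℝ) ^ 2 ≤ fairBits.real {ω : ℕ → Bool | ∃ (t : ℕ) (f : State),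
      Exec dec p (initState x d ω) t f ∧ s(f.reg 0, f.reg 1) = s((i : ℕ), (j : ℕ))}

end RAM

/-!
The algorithm hashes the words by random subcubes of `{0,1}^m`: every coordinate is independently
fixed to `0` with probability `p ≈ min δ (1 / 2)`, fixed to `1` with probability `p`, and left free
otherwise. A round draws a subcube and puts each word into the bucket given by its free coordinates,
but stores only the words that disagree with at most `d / 2` fixed coordinates. Two words stored in
the same bucket are then at distance at most `d`, so unless they are the closest pair itself, no
word displaces another, and one comparison per word suffices.

The closest pair is found in a round if the `d` coordinates in which it differs are all fixed, half
of them in favour of each word, and no other coordinate is fixed to the wrong value. This happens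
with probability `choose d (d / 2) * p ^ d * (1 - p) ^ (m - d)`, which is at least
`2 ^ ((δ - H₂(p)) m)` up to a polynomial factor. As `n ≤ 2 ^ (m + 1)`, polynomially many times
`2 ^ ((H₂(p) - δ) m)` rounds make the probability of failure at most `1 / n ^ 2`.

This algorithm serves both parts, without calling a decoder. If `δ ≤ 1 / 2`, then `p ≈ δ` and
`H₂(δ) - δ ≤ 1 - κ_Z(δ) - δ`. If `δ > 1 / 2`, then the exponent is `1 - δ`; here `κ_Z(δ) = 0`, and
the Plotkin bound bounds a code of distance `d + 1` by a polynomial in `m`, so that such a code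
meets the Gilbert-Varshamov bound only if `2 ^ ((1 - H₂(δ)) m)` is bounded by this polynomial.
-/

namespace RAM

/-! ### A cost logic for the random access machine -/

/-- A bound for the number of nodes of an expression plus the sum of its literals. -/
def Exp.weight : Exp → ℕ
  | .lit k => k + 1
  | .var _ => 1
  | .get _ e => e.weight + 1
  | .add e₁ e₂ => e₁.weight + e₂.weight + 1
  | .sub e₁ e₂ => e₁.weight + e₂.weight + 1
  | .mul e₁ e₂ => e₁.weight + e₂.weight + 1
  | .div e₁ e₂ => e₁.weight + e₂.weight + 1
  | .lt e₁ e₂ => e₁.weight + e₂.weight + 1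
  | .eq e₁ e₂ => e₁.weight + e₂.weight + 1

instance : Add Exp := ⟨.add⟩
instance : Sub Exp := ⟨.sub⟩
instance : Mul Exp := ⟨.mul⟩
instance : Div Exp := ⟨.div⟩
instance (k : ℕ) : OfNat Exp k := ⟨.lit k⟩

infixr:50 " ;; " => Prog.seq
infix:55 " ≔ " => Prog.assign

section eval

variable (s : State) (e₁ e₂ : Exp)

@[simp] theorem Exp.eval_add : (e₁ + e₂).eval s = e₁.eval s + e₂.eval s := rfl
@[simp] theorem Exp.eval_sub : (e₁ - e₂).eval s = e₁.eval s - e₂.eval s := rfl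
@[simp] theorem Exp.eval_mul : (e₁ * e₂).eval s = e₁.eval s * e₂.eval s := rfl
@[simp] theorem Exp.eval_div : (e₁ / e₂).eval s = e₁.eval s / e₂.eval s := rfl
@[simp] theorem Exp.eval_ofNat (k : ℕ) :
    (ofNat(k) : Exp).eval s = OfNat.ofNat k := rfl
@[simp] theorem Exp.eval_var (r : ℕ) : (Exp.var r).eval s = s.reg r := rfl
@[simp] theorem Exp.eval_get (a : ℕ) (e : Exp) : (Exp.get a e).eval s = s.arr a (e.eval s) := rfl
@[simp] theorem Exp.eval_lt :
    (Exp.lt e₁ e₂).eval s = if e₁.eval s < e₂.eval s then 1 else 0 := rfl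
@[simp] theorem Exp.eval_eq :
    (Exp.eq e₁ e₂).eval s = if e₁.eval s = e₂.eval s then 1 else 0 := rfl

end eval

section update

variable (s : State) (r v a k : ℕ)

@[simp] theorem State.setReg_reg (r' : ℕ) :
    (s.setReg r v).reg r' = if r' = r then v else s.reg r' := Function.update_apply ..
@[simp] theorem State.setReg_arr : (s.setReg r v).arr = s.arr := rfl
@[simp] theorem State.setReg_tape : (s.setReg r v).tape = s.tape := rfl
@[simp] theorem State.setArr_arr (a' : ℕ) :
    (s.setArr a k v).arr a' = if a' = a then Function.update (s.arr a) k v else s.arr a' :=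
  Function.update_apply ..
@[simp] theorem State.flipInto_reg (r' : ℕ) :
    (s.flipInto r).reg r' = if r' = r then (s.tape 0).toNat else s.reg r' :=
  Function.update_apply ..
@[simp] theorem State.flipInto_tape : (s.flipInto r).tape = fun l => s.tape (l + 1) := rfl

end update

/-- All registers and cells hold numbers of at most `W` bits. -/
structure Bounded (W : ℕ) (s : State) : Prop where
  reg_lt : ∀ r, s.reg r < 2 ^ W
  arr_lt : ∀ a k, s.arr a k < 2 ^ W

/-- The weight up to which evaluating an expression counts as an elementary step. -/
def maxWeight : ℕ := 20

/-- A bound for the cost of an elementary step on numbers of at most `W` bits. -/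
def unitCost (W : ℕ) : ℕ := 2 * (maxWeight * (1 + W * maxWeight)) + 1

theorem unitCost_pos {W : ℕ} : 1 ≤ unitCost W := Nat.succ_pos _

theorem node_cost_le {W c₁ c₂ v w₁ w₂ : ℕ} (h₁ : c₁ ≤ w₁ * (1 + W * w₁))
    (h₂ : c₂ ≤ w₂ * (1 + W * w₂)) (hv : v ≤ W * (w₁ + w₂ + 1)) :
    1 + v + c₁ + c₂ ≤ (w₁ + w₂ + 1) * (1 + W * (w₁ + w₂ + 1)) := by
  nlinarith [Nat.zero_le (W * w₁), Nat.zero_le (W * w₂), Nat.zero_le (W * w₁ * w₂)]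

section cost

variable {W : ℕ} [NeZero W] {s : State}

theorem lt_two_pow_of_le_succ_mul_succ {v v₁ v₂ w₁ w₂ : ℕ} (h₁ : v₁ < 2 ^ (W * w₁))
    (h₂ : v₂ < 2 ^ (W * w₂)) (h : v ≤ (v₁ + 1) * (v₂ + 1)) : v < 2 ^ (W * (w₁ + w₂ + 1)) :=
  calc v ≤ 2 ^ (W * w₁) * 2 ^ (W * w₂) := h.trans (Nat.mul_le_mul h₁ h₂)
    _ < 2 ^ (W * (w₁ + w₂ + 1)) := by
      rw [← pow_add, ← mul_add]
      exact Nat.pow_lt_pow_right one_lt_two (Nat.mul_lt_mul_of_pos_left (by omega) (NeZero.pos W))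

theorem Bounded.eval_lt (hs : Bounded W s) (e : Exp) : e.eval s < 2 ^ (W * e.weight) := by
  have hW : 0 < W := NeZero.pos W
  induction e with
  | lit k =>
    calc k < 2 ^ k := Nat.lt_two_pow_self
      _ ≤ 2 ^ (W * (k + 1)) := Nat.pow_le_pow_right two_pos (by nlinarith)
  | var r => simpa [Exp.weight] using hs.reg_lt r
  | get a e =>
    calc (Exp.get a e).eval s < 2 ^ W := hs.arr_lt _ _
      _ ≤ 2 ^ (W * (e.weight + 1)) := Nat.pow_le_pow_right two_pos (by nlinarith)
  | add e₁ e₂ h₁ h₂ | mul e₁ e₂ h₁ h₂ =>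
    exact lt_two_pow_of_le_succ_mul_succ h₁ h₂ (by simp only [Exp.eval]; nlinarith)
  | sub e₁ e₂ h₁ h₂ =>
    exact lt_two_pow_of_le_succ_mul_succ h₁ h₂ ((Nat.sub_le _ _).trans (by nlinarith))
  | div e₁ e₂ h₁ h₂ =>
    exact lt_two_pow_of_le_succ_mul_succ h₁ h₂ ((Nat.div_le_self _ _).trans (by nlinarith))
  | lt e₁ e₂ h₁ h₂ | eq e₁ e₂ h₁ h₂ =>
    exact lt_two_pow_of_le_succ_mul_succ h₁ h₂ (by simp only [Exp.eval]; split_ifs <;> nlinarith)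

theorem Bounded.cost_le (hs : Bounded W s) (e : Exp) :
    e.cost s ≤ e.weight * (1 + W * e.weight) := by
  have size_le (e : Exp) : Nat.size (e.eval s) ≤ W * e.weight := Nat.size_le.2 (hs.eval_lt e)
  induction e with
  | lit k =>
    exact (Nat.add_le_add_left (size_le (.lit k)) 1).trans (Nat.le_mul_of_pos_left _ k.succ_pos)
  | var r => exact (Nat.add_le_add_left (size_le (.var r)) 1).trans (one_mul _).ge
  | get a e ih =>
    exact node_cost_le (w₂ := 0) (c₂ := 0) ih (Nat.zero_le _) (size_le (.get a e))
  | add e₁ e₂ h₁ h₂ => exact node_cost_le h₁ h₂ (size_le (.add e₁ e₂))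
  | sub e₁ e₂ h₁ h₂ => exact node_cost_le h₁ h₂ (size_le (.sub e₁ e₂))
  | mul e₁ e₂ h₁ h₂ => exact node_cost_le h₁ h₂ (size_le (.mul e₁ e₂))
  | div e₁ e₂ h₁ h₂ => exact node_cost_le h₁ h₂ (size_le (.div e₁ e₂))
  | lt e₁ e₂ h₁ h₂ => exact node_cost_le h₁ h₂ (size_le (.lt e₁ e₂))
  | eq e₁ e₂ h₁ h₂ => exact node_cost_le h₁ h₂ (size_le (.eq e₁ e₂))

/-- The factor `2` is there for `store`, which evaluates two expressions. -/
theorem Bounded.cost_le_unitCost (hs : Bounded W s) {e : Exp} (he : e.weight ≤ maxWeight) :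
    2 * e.cost s + 1 ≤ unitCost W := by
  have : e.cost s ≤ maxWeight * (1 + W * maxWeight) := (hs.cost_le e).trans (by gcongr)
  unfold unitCost
  omega

end cost

theorem Bounded.setReg {W r v : ℕ} {s : State} (hs : Bounded W s) (hv : v < 2 ^ W) :
    Bounded W (s.setReg r v) := by
  refine ⟨fun r' => ?_, hs.arr_lt⟩
  rw [State.setReg_reg]
  split_ifs
  exacts [hv, hs.reg_lt r']

theorem Bounded.setArr {W a k v : ℕ} {s : State} (hs : Bounded W s) (hv : v < 2 ^ W) :
    Bounded W (s.setArr a k v) := by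
  refine ⟨hs.reg_lt, fun a' k' => ?_⟩
  rw [State.setArr_arr]
  split_ifs
  · rw [Function.update_apply]
    split_ifs
    exacts [hv, hs.arr_lt a k']
  · exact hs.arr_lt a' k'

theorem Bounded.flipInto {W r : ℕ} [NeZero W] {s : State} (hs : Bounded W s) :
    Bounded W (s.flipInto r) := by
  refine ⟨fun r' => ?_, hs.arr_lt⟩
  rw [State.flipInto_reg]
  split_ifs
  · exact (Bool.toNat_lt _).trans_le (Nat.pow_le_pow_right two_pos (NeZero.pos W))
  · exact hs.reg_lt r'

/-- The program never writes to register `r`. -/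
def Prog.keepsReg (r : ℕ) : Prog → Bool
  | .skip | .store .. | .decode .. => true
  | .assign r' _ | .flip r' => r' != r
  | .seq p q | .ite _ p q => p.keepsReg r && q.keepsReg r
  | .loop _ p => p.keepsReg r

/-- The program never writes to array `a`. -/
def Prog.keepsArr (a : ℕ) : Prog → Bool
  | .skip | .assign .. | .flip _ => true
  | .store a' _ _ | .decode _ a' => a' != a
  | .seq p q | .ite _ p q => p.keepsArr a && q.keepsArr a
  | .loop _ p => p.keepsArr a

/-- The program never reads the random tape. -/
def Prog.keepsTape : Prog → Bool
  | .skip | .assign .. | .store .. | .decode .. => true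
  | .flip _ => false
  | .seq p q | .ite _ p q => p.keepsTape && q.keepsTape
  | .loop _ p => p.keepsTape

/-- The registers and arrays that the expression reads are never written by the program. -/
def Exp.unaffectedBy (p : Prog) : Exp → Bool
  | .lit _ => true
  | .var r => p.keepsReg r
  | .get a e => p.keepsArr a && e.unaffectedBy p
  | .add e₁ e₂ | .sub e₁ e₂ | .mul e₁ e₂ | .div e₁ e₂ | .lt e₁ e₂ | .eq e₁ e₂ =>
    e₁.unaffectedBy p && e₂.unaffectedBy p

/-- What the program `p` never touches is the same in `s` and `s'`. -/
structure Frame (p : Prog) (s s' : State) : Prop where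
  reg : ∀ r, p.keepsReg r = true → s'.reg r = s.reg r
  arr : ∀ a, p.keepsArr a = true → s'.arr a = s.arr a
  tape : p.keepsTape = true → s'.tape = s.tape

section frame

variable {p q : Prog} {s s' s'' : State}

theorem Frame.refl (p : Prog) (s : State) : Frame p s s :=
  ⟨fun _ _ => rfl, fun _ _ => rfl, fun _ => rfl⟩

theorem Frame.trans (h : Frame p s s') (h' : Frame p s' s'') : Frame p s s'' :=
  ⟨fun r hr => (h'.reg r hr).trans (h.reg r hr), fun a ha => (h'.arr a ha).trans (h.arr a ha),
    fun ht => (h'.tape ht).trans (h.tape ht)⟩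

theorem Frame.seq_left (h : Frame p s s') : Frame (p ;; q) s s' :=
  ⟨fun r hr => h.reg r (Bool.and_elim_left hr), fun a ha => h.arr a (Bool.and_elim_left ha),
    fun ht => h.tape (Bool.and_elim_left ht)⟩

theorem Frame.seq_right (h : Frame q s s') : Frame (p ;; q) s s' :=
  ⟨fun r hr => h.reg r (Bool.and_elim_right hr), fun a ha => h.arr a (Bool.and_elim_right ha),
    fun ht => h.tape (Bool.and_elim_right ht)⟩

theorem Frame.assign (r : ℕ) (e : Exp) (s : State) :
    Frame (r ≔ e) s (s.setReg r (e.eval s)) := by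
  refine ⟨fun r' hr => ?_, fun _ _ => rfl, fun _ => rfl⟩
  rw [State.setReg_reg, if_neg (bne_iff_ne.1 hr).symm]

variable {m : ℕ} {dec : Option (BinWord m → BinWord m)} {t : ℕ}

theorem Exec.frame (h : Exec dec p s t s') : Frame p s s' := by
  induction h with
  | skip s => exact .refl _ _
  | assign r e s => exact .assign r e s
  | store a e₁ e₂ s =>
    refine ⟨fun _ _ => rfl, fun a' ha => ?_, fun _ => rfl⟩
    rw [State.setArr_arr, if_neg (bne_iff_ne.1 ha).symm]
  | flip r s =>
    refine ⟨fun r' hr => ?_, fun _ _ => rfl, fun h => absurd h Bool.false_ne_true⟩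
    rw [State.flipInto_reg, if_neg (bne_iff_ne.1 hr).symm]
  | decode a b s D _ =>
    exact ⟨fun _ _ => rfl, fun a' ha => Function.update_of_ne (bne_iff_ne.1 ha).symm _ _,
      fun _ => rfl⟩
  | seq _ _ ihp ihq => exact ihp.seq_left.trans ihq.seq_right
  -- `ite` and `seq` are kept by the same registers and arrays, so their frames coincide.
  | iteTrue _ _ ih => exact ⟨ih.seq_left.reg, ih.seq_left.arr, ih.seq_left.tape⟩
  | iteFalse _ _ ih => exact ⟨ih.seq_right.reg, ih.seq_right.arr, ih.seq_right.tape⟩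
  | loopDone _ => exact .refl _ _
  | loopStep _ _ _ ihp ihl => exact .trans ⟨ihp.reg, ihp.arr, ihp.tape⟩ ihl

theorem Frame.eval_eq (h : Frame p s s') {e : Exp} (he : e.unaffectedBy p = true) :
    e.eval s' = e.eval s := by
  induction e with
  | lit k => rfl
  | var r => exact h.reg r he
  | get a e ih =>
    simp only [Exp.unaffectedBy, Bool.and_eq_true] at he
    simp only [Exp.eval_get, h.arr a he.1, ih he.2]
  | _ e₁ e₂ ih₁ ih₂ =>
    simp only [Exp.unaffectedBy, Bool.and_eq_true] at he
    simp only [Exp.eval, ih₁ he.1, ih₂ he.2]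

end frame

section rules

variable {m : ℕ} {dec : Option (BinWord m → BinWord m)} {W N N₁ N₂ r a v w : ℕ}
  {Q Q' : State → Prop} {s : State} {e e₁ e₂ : Exp} {p q : Prog}

/-- A total-correctness triple with running time: started in the state `s`, if it is `W`-bounded,
the program `p` halts after at most `N` elementary steps in a `W`-bounded state that satisfies
`Q`. -/
def Wp (dec : Option (BinWord m → BinWord m)) (W N : ℕ) (p : Prog) (Q : State → Prop)
    (s : State) : Prop :=
  Bounded W s → ∃ t s', Exec dec p s t s' ∧ t ≤ N * unitCost W ∧ Bounded W s' ∧ Q s'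

theorem Wp.mono (h : Wp dec W N p Q s)
    (hQ : ∀ s', Frame p s s' → Bounded W s' → Q s' → Q' s') : Wp dec W N p Q' s := by
  intro hs
  obtain ⟨t, s', hp, ht, hs', hq⟩ := h hs
  exact ⟨t, s', hp, ht, hs', hQ _ hp.frame hs' hq⟩

theorem Wp.steps_mono (h : Wp dec W N₁ p Q s) (hN : N₁ ≤ N₂) : Wp dec W N₂ p Q s := by
  intro hs
  obtain ⟨t, s', hp, ht, hs', hq⟩ := h hs
  exact ⟨t, s', hp, ht.trans (Nat.mul_le_mul_right _ hN), hs', hq⟩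

theorem Wp.skip [NeZero W] (h : Q s) : Wp dec W 1 .skip Q s := fun hs =>
  ⟨1, s, .skip s, by simpa only [one_mul] using unitCost_pos, hs, h⟩

theorem Wp.assign [NeZero W] (he : e.eval s = v) (hv : v < 2 ^ W) (h : Q (s.setReg r v))
    (hw : e.weight ≤ maxWeight := by decide) : Wp dec W 1 (r ≔ e) Q s := by
  subst he
  intro hs
  have := hs.cost_le_unitCost hw
  exact ⟨_, _, .assign r e s, by omega, hs.setReg hv, h⟩

theorem Wp.store [NeZero W] (he₁ : e₁.eval s = w) (he₂ : e₂.eval s = v) (hv : v < 2 ^ W)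
    (h : Q (s.setArr a w v)) (hw₁ : e₁.weight ≤ maxWeight := by decide)
    (hw₂ : e₂.weight ≤ maxWeight := by decide) : Wp dec W 1 (.store a e₁ e₂) Q s := by
  subst he₁ he₂
  intro hs
  have := hs.cost_le_unitCost hw₁
  have := hs.cost_le_unitCost hw₂
  exact ⟨_, _, .store a e₁ e₂ s, by omega, hs.setArr hv, h⟩

theorem Wp.flip [NeZero W] (h : Q (s.flipInto r)) : Wp dec W 1 (.flip r) Q s := fun hs =>
  ⟨_, _, .flip r s, by simpa only [one_mul] using unitCost_pos, hs.flipInto, h⟩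

theorem Wp.seq (h : Wp dec W N₁ p (Wp dec W N₂ q Q) s) : Wp dec W (N₁ + N₂) (p ;; q) Q s := by
  intro hs
  obtain ⟨t, s', hp, ht, hs', hq⟩ := h hs
  obtain ⟨t', s'', hq', ht', hs'', hQ⟩ := hq hs'
  exact ⟨_, _, .seq hp hq', by rw [add_mul]; omega, hs'', hQ⟩

theorem Wp.ite [NeZero W] (h₁ : e.eval s ≠ 0 → Wp dec W N p Q s)
    (h₂ : e.eval s = 0 → Wp dec W N q Q s) (hw : e.weight ≤ maxWeight := by decide) :
    Wp dec W (N + 1) (.ite e p q) Q s := by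
  intro hs
  have := hs.cost_le_unitCost hw
  by_cases h : e.eval s = 0
  · obtain ⟨t, s', hq, ht, hs', hQ⟩ := h₂ h hs
    exact ⟨_, _, .iteFalse h hq, by rw [add_mul]; omega, hs', hQ⟩
  · obtain ⟨t, s', hp, ht, hs', hQ⟩ := h₁ h hs
    exact ⟨_, _, .iteTrue h hp, by rw [add_mul]; omega, hs', hQ⟩

/-- The iterations of a `for` loop: `while c < bnd do (body; c := c + 1)`. -/
def countLoop (c : ℕ) (bnd : Exp) (body : Prog) : Prog :=
  .loop (.lt (.var c) bnd) (body ;; c ≔ .var c + 1)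

/-- `for c := 0, …, bnd - 1 do body`. -/
def forLoop (c : ℕ) (bnd : Exp) (body : Prog) : Prog :=
  c ≔ 0 ;; countLoop c bnd body

variable {c k K : ℕ} {bnd : Exp} {body : Prog} {I : ℕ → State → Prop}

theorem Wp.countLoop_done [NeZero W] (hbnd : bnd.eval s = K) (hc : s.reg c = K) (h : Q s)
    (hw : bnd.weight + 2 ≤ maxWeight) : Wp dec W 1 (countLoop c bnd body) Q s := by
  intro hs
  have := hs.cost_le_unitCost (e := .lt (.var c) bnd) (by simp only [Exp.weight]; omega)
  exact ⟨_, _, .loopDone (by simp [hbnd, hc]), by omega, hs, h⟩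

theorem Wp.countLoop_step [NeZero W] (hbnd : bnd.eval s = K) (hc : s.reg c = k) (hk : k < K)
    (hK : K < 2 ^ W) (hbody : body.keepsReg c = true) (hw : bnd.weight + 2 ≤ maxWeight)
    (h : Wp dec W N₁ body (fun s' => Wp dec W N₂ (countLoop c bnd body) Q (s'.setReg c (k + 1)))
      s) : Wp dec W (N₁ + 2 + N₂) (countLoop c bnd body) Q s := by
  intro hs
  obtain ⟨t, s', hp, ht, hs', hrest⟩ := h hs
  have hinc : (Exp.var c + 1).eval s' = k + 1 := by simp [hp.frame.reg c hbody, hc]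
  obtain ⟨t', s'', hl, ht', hs'', hQ⟩ := hrest (hs'.setReg (by omega))
  have hassign := Exec.assign (dec := dec) c (.var c + 1) s'
  rw [hinc] at hassign
  have := hs.cost_le_unitCost (e := .lt (.var c) bnd) (by simp only [Exp.weight]; omega)
  have := hs'.cost_le_unitCost (e := Exp.var c + 1) (show 4 ≤ maxWeight by decide)
  refine ⟨_, s'', .loopStep ?_ (.seq hp hassign) hl, ?_, hs'', hQ⟩
  · simp [hbnd, hc, hk]
  · simp only [add_mul]
    omega

theorem Wp.countLoop [NeZero W] (hw : bnd.weight + 2 ≤ maxWeight) (hK : K < 2 ^ W)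
    (hbody : body.keepsReg c = true) (hbnd : ∀ k s', I k s' → bnd.eval s' = K)
    (hc : ∀ k s', I k s' → s'.reg c = k)
    (hstep : ∀ k < K, ∀ s', I k s' →
      Wp dec W N body (fun s'' => I (k + 1) (s''.setReg c (k + 1))) s')
    (hk : k ≤ K) (h : I k s) :
    Wp dec W ((K - k) * (N + 2) + 1) (RAM.countLoop c bnd body) (I K) s := by
  induction hk using Nat.decreasingInduction generalizing s with
  | self => simpa using Wp.countLoop_done (hbnd _ _ h) (hc _ _ h) h hw
  | of_succ k hkK ih =>
    refine Wp.steps_mono (Wp.countLoop_step (hbnd _ _ h) (hc _ _ h) hkK hK hbody hw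
      ((hstep k hkK s h).mono fun s' _ _ h' => ih h')) (le_of_eq ?_)
    rw [show K - k = K - (k + 1) + 1 by omega]
    ring

/-- The invariant `I` may not depend on the counter, the value of which is its first argument. -/
theorem Wp.forLoop [NeZero W] (I : ℕ → State → Prop) (hbnd : bnd.eval s = K) (hK : K < 2 ^ W)
    (h0 : I 0 s)
    (hstep : ∀ k < K, ∀ s', Frame (forLoop c bnd body) s s' → s'.reg c = k → I k s' →
      Wp dec W N body (I (k + 1)) s')
    (hI : ∀ k s v, I k (s.setReg c v) ↔ I k s := by simp)
    (hbody : body.keepsReg c = true := by rfl)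
    (hun : bnd.unaffectedBy (forLoop c bnd body) = true := by rfl)
    (hw : bnd.weight + 2 ≤ maxWeight := by decide) :
    Wp dec W (K * (N + 2) + 2) (RAM.forLoop c bnd body) (I K) s := by
  have init : (0 : Exp).eval s = 0 := rfl
  have frame₀ : Frame (RAM.forLoop c bnd body) s (s.setReg c 0) :=
    (Frame.assign c 0 s).seq_left
  have iterations := Wp.countLoop (dec := dec) (W := W) (N := N) (K := K) (k := 0) (c := c)
    (bnd := bnd) (body := body) (s := s.setReg c 0)
    (I := fun k s' => Frame (RAM.forLoop c bnd body) s s' ∧ s'.reg c = k ∧ I k s')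
    hw hK hbody (fun k s' h => (h.1.eval_eq hun).trans hbnd) (fun k s' h => h.2.1)
    (fun k hk s' h => (hstep k hk s' h.1 h.2.1 h.2.2).mono fun s'' hf _ h' =>
      ⟨?_, by simp, (hI _ _ _).2 h'⟩) (Nat.zero_le K) ⟨frame₀, by simp, (hI _ _ _).2 h0⟩
  · refine Wp.steps_mono (.seq (.assign init (by positivity)
      (iterations.mono fun s' _ _ h => h.2.2))) (by rw [Nat.sub_zero]; omega)
  · have inc : (Exp.var c + 1).eval s'' = k + 1 := by simp [hf.reg c hbody, h.2.1]
    have hstep_frame : Frame (body ;; c ≔ .var c + 1) s' (s''.setReg c (k + 1)) :=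
      inc ▸ hf.seq_left.trans (Frame.assign c (.var c + 1) s'').seq_right
    exact h.1.trans (Frame.seq_right ⟨hstep_frame.reg, hstep_frame.arr, hstep_frame.tape⟩)

/-- `dst := init; for c := 0, …, bnd - 1 do dst := step`. -/
def accumulate (c dst : ℕ) (bnd init step : Exp) : Prog :=
  dst ≔ init ;; forLoop c bnd (dst ≔ step)

variable {dst : ℕ} {init step : Exp} {f : ℕ → ℕ}

theorem Wp.accumulate [NeZero W] (hbnd : bnd.eval s = K) (hK : K < 2 ^ W)
    (hinit : init.eval s = f 0) (hf : ∀ k ≤ K, f k < 2 ^ W)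
    (hstep : ∀ k < K, ∀ s', Frame (accumulate c dst bnd init step) s s' → s'.reg c = k →
      s'.reg dst = f k → step.eval s' = f (k + 1))
    (hdst : dst ≠ c := by decide)
    (hun : bnd.unaffectedBy (RAM.accumulate c dst bnd init step) = true := by rfl)
    (hun' : bnd.unaffectedBy (RAM.forLoop c bnd (dst ≔ step)) = true := by rfl)
    (hw : bnd.weight + 2 ≤ maxWeight := by decide) (hw_init : init.weight ≤ maxWeight := by decide)
    (hw_step : step.weight ≤ maxWeight := by decide) :
    Wp dec W (K * 3 + 3) (RAM.accumulate c dst bnd init step) (fun s' => s'.reg dst = f K) s := by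
  have frame₀ : Frame (RAM.accumulate c dst bnd init step) s (s.setReg dst (f 0)) :=
    hinit ▸ (Frame.assign dst init s).seq_left
  have loop : Wp dec W (K * (1 + 2) + 2) (RAM.forLoop c bnd (dst ≔ step))
      (fun s' => s'.reg dst = f K) (s.setReg dst (f 0)) :=
    .forLoop (fun k s' => s'.reg dst = f k) ((frame₀.eval_eq hun).trans hbnd) hK (by simp)
      (fun k hk s' hframe hc hacc =>
        .assign (hstep k hk s' (frame₀.trans hframe.seq_right) hc hacc) (hf _ hk) (by simp) hw_step)
      (by simp [hdst]) (bne_iff_ne.2 hdst) hun' hw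
  exact .steps_mono (.seq (.assign hinit (hf 0 K.zero_le) loop hw_init)) (by omega)

/-- `dst := b ^ e`. -/
def power (c dst : ℕ) (b e : Exp) : Prog := accumulate c dst e 1 (.var dst * b)

theorem Wp.power [NeZero W] {b e : Exp} (hb : b.eval s = v) (he : e.eval s = K) (hK : K < 2 ^ W)
    (hv : ∀ k ≤ K, v ^ k < 2 ^ W) (hdst : dst ≠ c := by decide)
    (hun : e.unaffectedBy (RAM.power c dst b e) = true := by rfl)
    (hun' : e.unaffectedBy (RAM.forLoop c e (dst ≔ .var dst * b)) = true := by rfl)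
    (hun_b : b.unaffectedBy (RAM.power c dst b e) = true := by rfl)
    (hw : e.weight + 2 ≤ maxWeight := by decide)
    (hw_b : (Exp.var dst * b).weight ≤ maxWeight := by decide) :
    Wp dec W (K * 3 + 3) (RAM.power c dst b e) (fun s' => s'.reg dst = v ^ K) s :=
  .accumulate he hK (pow_zero v).symm hv
    (fun k _ s' hframe _ hacc => by
      rw [Exp.eval_mul, Exp.eval_var, hacc, hframe.eval_eq hun_b, hb, pow_succ])
    hdst hun hun' hw (by decide) hw_b

/-- `dst := #{c < bnd | test}`, for a `test` with values `0` and `1`. -/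
def count (c dst : ℕ) (bnd test : Exp) : Prog := accumulate c dst bnd 0 (.var dst + test)

theorem card_filter_val_lt_succ (P : Fin K → Prop) [DecidablePred P] (k : Fin K) :
    Finset.card {l : Fin K | (l : ℕ) < k + 1 ∧ P l} =
      Finset.card {l : Fin K | (l : ℕ) < k ∧ P l} + if P k then 1 else 0 := by
  have split (l : Fin K) : (l : ℕ) < k + 1 ∧ P l ↔ l = k ∧ P l ∨ (l : ℕ) < k ∧ P l := by
    rw [Nat.lt_succ_iff_lt_or_eq, Fin.ext_iff]
    tauto
  split_ifs with hk
  · rw [← Finset.card_insert_of_notMem (a := k) (by simp)]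
    congr 1
    ext l
    simp only [Finset.mem_filter_univ, Finset.mem_insert, split]
    exact or_congr_left ⟨And.left, fun h => ⟨h, h ▸ hk⟩⟩
  · rw [add_zero]
    congr 1
    ext l
    simp only [Finset.mem_filter_univ, split]
    exact or_iff_right fun h => hk (h.1 ▸ h.2)

theorem Wp.count [NeZero W] {test : Exp} {P : Fin K → Prop} [DecidablePred P]
    (hbnd : bnd.eval s = K) (hK : K < 2 ^ W)
    (htest : ∀ k : Fin K, ∀ s', Frame (count c dst bnd test) s s' → s'.reg c = k →
      test.eval s' = if P k then 1 else 0)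
    (hdst : dst ≠ c := by decide)
    (hun : bnd.unaffectedBy (RAM.count c dst bnd test) = true := by rfl)
    (hun' : bnd.unaffectedBy (RAM.forLoop c bnd (dst ≔ .var dst + test)) = true := by rfl)
    (hw : bnd.weight + 2 ≤ maxWeight := by decide)
    (hw_test : (Exp.var dst + test).weight ≤ maxWeight := by decide) :
    Wp dec W (K * 3 + 3) (RAM.count c dst bnd test)
      (fun s' => s'.reg dst = Finset.card {k | P k}) s := by
  refine (Wp.accumulate (f := fun k => Finset.card {l : Fin K | (l : ℕ) < k ∧ P l}) hbnd hK
    (by simp) (fun k _ => ?_) (fun k hk s' hframe hc hacc => ?_) hdst hun hun' hw (by decide)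
    hw_test).mono fun s' _ _ h => by simpa using h
  · exact ((Finset.card_filter_le _ _).trans_eq (Finset.card_fin K)).trans_lt hK
  · rw [Exp.eval_add, Exp.eval_var, hacc, htest ⟨k, hk⟩ s' hframe hc]
    exact (card_filter_val_lt_succ P ⟨k, hk⟩).symm

end rules

end RAM

namespace ClosestPair

/-! ### Partial words and buckets -/

/-- The number with the `l` binary digits `b 0, …, b (l - 1)`, the most significant digit first. -/
def bitsVal (b : ℕ → Bool) : ℕ → ℕ
  | 0 => 0
  | l + 1 => 2 * bitsVal b l + (b l).toNat

theorem bitsVal_lt (b : ℕ → Bool) (l : ℕ) : bitsVal b l < 2 ^ l := by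
  induction l with
  | zero => exact one_pos
  | succ l ih =>
    have := (b l).toNat_le
    rw [bitsVal, pow_succ]
    omega

theorem bitsVal_congr {b b' : ℕ → Bool} {l : ℕ} (h : ∀ k < l, b k = b' k) :
    bitsVal b l = bitsVal b' l := by
  induction l with
  | zero => rfl
  | succ l ih => rw [bitsVal, bitsVal, ih fun k hk => h k (by omega), h l (by omega)]

theorem eq_of_bitsVal_eq {b b' : ℕ → Bool} {l : ℕ} (h : bitsVal b l = bitsVal b' l) :
    ∀ k < l, b k = b' k := by
  induction l with
  | zero => simp
  | succ l ih =>
    have := (b l).toNat_le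
    have := (b' l).toNat_le
    rw [bitsVal, bitsVal] at h
    intro k hk
    obtain hk | rfl := Nat.lt_succ_iff_lt_or_eq.1 hk
    · exact ih (by omega) k hk
    · have hbit : (b k).toNat = (b' k).toNat := by omega
      revert hbit
      cases b k <;> cases b' k <;> decide

section PartialWord

variable {m d : ℕ}

/-- The bits of a word, followed by zeros. -/
noncomputable def digits (y : BinWord m) : ℕ → Bool := Function.extend Fin.val y fun _ => false

theorem digits_val (y : BinWord m) (k : Fin m) : digits y k = y k :=
  Fin.val_injective.extend_apply _ _ _

/-- The number with binary digits `y`. -/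
noncomputable def wordVal (y : BinWord m) : ℕ := bitsVal (digits y) m

theorem wordVal_injective : Function.Injective (wordVal (m := m)) := by
  intro y y' h
  funext k
  simpa only [digits_val] using eq_of_bitsVal_eq h k k.is_lt

theorem wordVal_eq_bitsVal (b : ℕ → Bool) : wordVal (fun k : Fin m => b k) = bitsVal b m :=
  bitsVal_congr fun k hk => digits_val (fun k : Fin m => b k) ⟨k, hk⟩

/-- A subcube of `{0,1}^m`: the coordinates `k` with `σ k = some b` are fixed to `b`, those with
`σ k = none` are free. -/
abbrev PartialWord (m : ℕ) : Type := Fin m → Option Bool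

/-- The number of fixed coordinates of `σ` in which `y` disagrees, i.e. the distance of `y` from
the subcube `σ`. -/
def fixedDist (σ : PartialWord m) (y : BinWord m) : ℕ :=
  Finset.card {k | σ k = some (!y k)}

/-- The hash value of `y`: two words fall into the same bucket if they agree on the free
coordinates of `σ`. -/
noncomputable def bucket (σ : PartialWord m) (y : BinWord m) : ℕ :=
  wordVal fun k => y k && (σ k).isNone

theorem bucket_eq_iff {σ : PartialWord m} {y y' : BinWord m} :
    bucket σ y = bucket σ y' ↔ ∀ k, σ k = none → y k = y' k := by
  rw [bucket, bucket, wordVal_injective.eq_iff, funext_iff]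
  refine forall_congr' fun k => ?_
  cases σ k <;> simp

theorem hammingDist_le_of_bucket_eq {σ : PartialWord m} {y y' : BinWord m}
    (h : bucket σ y = bucket σ y') : hammingDist y y' ≤ fixedDist σ y + fixedDist σ y' := by
  refine (Finset.card_le_card fun k hk => ?_).trans (Finset.card_union_le _ _)
  have hne : y k ≠ y' k := (Finset.mem_filter.1 hk).2
  simp only [Finset.mem_union, Finset.mem_filter_univ]
  cases hσ : σ k with
  | none => exact absurd (bucket_eq_iff.1 h k hσ) hne
  | some b =>
    cases b <;> cases hy : y k <;> cases hy' : y' k <;> simp_all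

/-- The event that makes the algorithm discover the pair `y, y'` at distance `d`. -/
def Reveals (σ : PartialWord m) (d : ℕ) (y y' : BinWord m) : Prop :=
  fixedDist σ y ≤ d / 2 ∧ bucket σ y = bucket σ y'

end PartialWord

/-! ### The scan of one round -/

section scan

variable {n m d : ℕ} {x : Fin n → BinWord m} {i j : Fin n}

theorem _root_.IsUniqueClosestPair.symm (h : IsUniqueClosestPair x i j d) :
    IsUniqueClosestPair x j i d :=
  ⟨h.1.symm, by rw [hammingDist_comm]; exact h.2.1,
    fun a b hab hne => h.2.2 a b hab (by rwa [Sym2.eq_swap (a := i)])⟩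

theorem _root_.IsUniqueClosestPair.eq_of_hammingDist_le (h : IsUniqueClosestPair x i j d)
    {a b : Fin n} (hab : a ≠ b) (hd : hammingDist (x a) (x b) ≤ d) : s(a, b) = s(i, j) :=
  by_contra fun hne => (h.2.2 a b hab hne).not_ge hd

theorem hammingDist_le_dim {y y' : BinWord m} (h : hammingDist y y' = d) : d ≤ m := by
  simpa [h] using hammingDist_le_card_fintype (x := y) (y := y')

theorem _root_.IsUniqueClosestPair.le_dim (h : IsUniqueClosestPair x i j d) : d ≤ m :=
  hammingDist_le_dim h.2.1

theorem _root_.IsUniqueClosestPair.two_le (h : IsUniqueClosestPair x i j d) : 2 ≤ n := by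
  have := Fin.val_ne_of_ne h.1
  omega

/-- Only `x i` and `x j` may coincide. -/
theorem _root_.IsUniqueClosestPair.card_le (h : IsUniqueClosestPair x i j d) :
    n ≤ 2 ^ (m + 1) := by
  have hinj : Set.InjOn x ({j}ᶜ : Finset (Fin n)) := by
    intro a ha b hb hab
    by_contra hne
    have hpair := h.eq_of_hammingDist_le hne (by simp [hab])
    simp only [Finset.coe_compl, Finset.coe_singleton, Set.mem_compl_iff,
      Set.mem_singleton_iff] at ha hb
    rw [Sym2.eq_iff] at hpair
    tauto
  have hcard := Finset.card_le_card_of_injOn x (fun _ _ => Finset.mem_univ _) hinj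
  rw [Finset.card_compl, Finset.card_singleton, Fintype.card_fin, Finset.card_univ,
    Fintype.card_pi_const, Fintype.card_bool] at hcard
  have := Nat.one_le_two_pow (n := m)
  rw [pow_succ]
  omega

/-- What the algorithm remembers of the words seen so far: the last word stored in each bucket, and
the pair of words found last. -/
structure Memory (n : ℕ) where
  table : ℕ → Fin n
  pair : Fin n × Fin n

/-- The words `i` and `j` have been found, in some order. -/
def Memory.Found (M : Memory n) (i j : Fin n) : Prop := s(M.pair.1, M.pair.2) = s(i, j)

/-- Compares `x p` with the word in its bucket, and puts it into the bucket if it is at distance at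
most `d / 2` from the subcube `σ`. -/
noncomputable def Memory.visit (M : Memory n) (x : Fin n → BinWord m) (d : ℕ)
    (σ : PartialWord m) (p : Fin n) : Memory n where
  table := if fixedDist σ (x p) ≤ d / 2 then Function.update M.table (bucket σ (x p)) p
    else M.table
  pair := if hammingDist (x p) (x (M.table (bucket σ (x p)))) = d ∧ M.table (bucket σ (x p)) ≠ p
    then (p, M.table (bucket σ (x p))) else M.pair

variable {σ : PartialWord m} {M M₀ : Memory n} {p : Fin n}

theorem Memory.table_visit (M : Memory n) : (M.visit x d σ p).table =
    if fixedDist σ (x p) ≤ d / 2 then Function.update M.table (bucket σ (x p)) p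
    else M.table := rfl

theorem Memory.pair_visit (M : Memory n) : (M.visit x d σ p).pair =
    if hammingDist (x p) (x (M.table (bucket σ (x p)))) = d ∧ M.table (bucket σ (x p)) ≠ p
    then (p, M.table (bucket σ (x p))) else M.pair := rfl

theorem Memory.found_visit (h : IsUniqueClosestPair x i j d) (hq : M.table (bucket σ (x p)) ≠ p)
    (hd : hammingDist (x p) (x (M.table (bucket σ (x p)))) = d) :
    (M.visit x d σ p).Found i j := by
  rw [Memory.Found, Memory.pair_visit, if_pos ⟨hd, hq⟩]
  exact h.eq_of_hammingDist_le hq.symm hd.le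

theorem Memory.Found.visit (hM : M.Found i j) (h : IsUniqueClosestPair x i j d) :
    (M.visit x d σ p).Found i j := by
  by_cases hq : hammingDist (x p) (x (M.table (bucket σ (x p)))) = d ∧
      M.table (bucket σ (x p)) ≠ p
  · exact Memory.found_visit h hq.2 hq.1
  · rwa [Memory.Found, Memory.pair_visit, if_neg hq]

/-- The state of a scan after the first `k` words, started with memory `M₀`. -/
structure ScanInvariant (x : Fin n → BinWord m) (i j : Fin n) (d : ℕ) (σ : PartialWord m)
    (M₀ M : Memory n) (k : ℕ) : Prop where
  found_of_found : M₀.Found i j → M.Found i j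
  table_eq : Reveals σ d (x i) (x j) → (i : ℕ) < k → k ≤ j → M.table (bucket σ (x i)) = i
  found : Reveals σ d (x i) (x j) → (j : ℕ) < k → M.Found i j

theorem ScanInvariant.zero (M : Memory n) : ScanInvariant x i j d σ M M 0 :=
  ⟨id, fun _ h => absurd h (Nat.not_lt_zero _), fun _ h => absurd h (Nat.not_lt_zero _)⟩

/-- A word that displaced `x i` would be stored in the same bucket, hence at distance at most
`d / 2 + d / 2` from `x i`. -/
theorem ScanInvariant.table_visit_eq (h : IsUniqueClosestPair x i j d)
    (hM : ScanInvariant x i j d σ M₀ M p) (hσ : Reveals σ d (x i) (x j)) (hip : i ≤ p)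
    (hpj : p < j) : (M.visit x d σ p).table (bucket σ (x i)) = i := by
  obtain rfl | hip := hip.eq_or_lt
  · rw [Memory.table_visit, if_pos hσ.1, Function.update_self]
  have hstored : M.table (bucket σ (x i)) = i := hM.table_eq hσ hip hpj.le
  rw [Memory.table_visit]
  split_ifs with hp
  · suffices bucket σ (x i) ≠ bucket σ (x p) by rwa [Function.update_of_ne this]
    intro hbucket
    have hclose : hammingDist (x i) (x p) ≤ d := by
      have := hammingDist_le_of_bucket_eq hbucket
      have := hσ.1
      omega
    exact hpj.ne (Sym2.congr_right.1 (h.eq_of_hammingDist_le hip.ne hclose))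
  · exact hstored

theorem ScanInvariant.succ (h : IsUniqueClosestPair x i j d) (hij : i < j)
    (hM : ScanInvariant x i j d σ M₀ M p) :
    ScanInvariant x i j d σ M₀ (M.visit x d σ p) (p + 1) where
  found_of_found h₀ := (hM.found_of_found h₀).visit h
  table_eq hσ hip hpj := hM.table_visit_eq h hσ (Nat.le_of_lt_succ hip) hpj
  found hσ hjp := by
    obtain hjp | hjp := Nat.lt_succ_iff_lt_or_eq.1 hjp
    · exact (hM.found hσ hjp).visit h
    obtain rfl := Fin.ext hjp
    have hstored : M.table (bucket σ (x j)) = i := hσ.2 ▸ hM.table_eq hσ hij le_rfl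
    refine Memory.found_visit h ?_ ?_ <;> rw [hstored]
    exacts [hij.ne, hammingDist_comm (x i) (x j) ▸ h.2.1]

end scan

/-! ### The algorithm -/

open RAM

-- Registers `0`, `1`, `2` and array `0` hold the input, registers `0` and `1` the output.
@[simp] abbrev Reg.numPoints : ℕ := 0
@[simp] abbrev Reg.dim : ℕ := 1
@[simp] abbrev Reg.dist : ℕ := 2
@[simp] abbrev Reg.scale : ℕ := 3
@[simp] abbrev Reg.threshold : ℕ := 4
@[simp] abbrev Reg.total : ℕ := 5
@[simp] abbrev Reg.factor : ℕ := 6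
@[simp] abbrev Reg.denom : ℕ := 7
@[simp] abbrev Reg.numRounds : ℕ := 8
@[simp] abbrev Reg.round : ℕ := 9
@[simp] abbrev Reg.coord : ℕ := 10
@[simp] abbrev Reg.bit : ℕ := 11
@[simp] abbrev Reg.coin : ℕ := 12
@[simp] abbrev Reg.draw : ℕ := 13
@[simp] abbrev Reg.point : ℕ := 14
@[simp] abbrev Reg.key : ℕ := 15
@[simp] abbrev Reg.fixedDist : ℕ := 16
@[simp] abbrev Reg.stored : ℕ := 17
@[simp] abbrev Reg.pairDist : ℕ := 18
@[simp] abbrev Reg.foundFst : ℕ := 19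
@[simp] abbrev Reg.foundSnd : ℕ := 20

@[simp] abbrev Arr.points : ℕ := 0
@[simp] abbrev Arr.cells : ℕ := 1
@[simp] abbrev Arr.table : ℕ := 2

/-- Computes `threshold m d`; the second assignment is a minimum, by truncated subtraction. -/
def thresholdProg : Prog :=
  Reg.threshold ≔ (.var Reg.scale * .var Reg.dist + .var Reg.dim - 1) / .var Reg.dim ;;
  Reg.threshold ≔ .var Reg.threshold - (.var Reg.threshold - .var Reg.scale / 2)

/-- Computes `numRounds m d`. -/
def numRoundsProg : Prog :=
  power Reg.coord Reg.total (.var Reg.scale) (.var Reg.dim) ;;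
  power Reg.coord Reg.denom (2 * .var Reg.threshold) (.var Reg.dist) ;;
  power Reg.coord Reg.factor (.var Reg.scale - .var Reg.threshold)
    (.var Reg.dim - .var Reg.dist) ;;
  Reg.denom ≔ .var Reg.denom * .var Reg.factor ;;
  Reg.numRounds ≔
    2 * ((.var Reg.dim + 1) * (.var Reg.dim + 1)) * .var Reg.total / .var Reg.denom + 1

/-- Computes the parameters of the random subcubes and the number of rounds. -/
def setupProg : Prog :=
  power Reg.coord Reg.scale 2 (.var Reg.dim + 2) ;; thresholdProg ;; numRoundsProg

/-- Draws a uniformly distributed number below `2 ^ (m + 2)`. -/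
def drawNumber : Prog :=
  Reg.draw ≔ 0 ;;
  forLoop Reg.bit (.var Reg.dim + 2)
    (.flip Reg.coin ;; Reg.draw ≔ 2 * .var Reg.draw + .var Reg.coin)

/-- Draws a subcube; the cells `0`, `1` and `2` stand for `some false`, `some true` and `none`. -/
def drawWord : Prog :=
  forLoop Reg.coord (.var Reg.dim)
    (drawNumber ;; .store Arr.cells (.var Reg.coord) (2 -
      .lt (.var Reg.draw) (.var Reg.threshold) - .lt (.var Reg.draw) (2 * .var Reg.threshold)))

/-- The current coordinate of the point whose number is in register `r`. -/
abbrev pointBit (r : ℕ) : Exp := .get Arr.points (.var r * .var Reg.dim + .var Reg.coord)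

/-- Computes the bucket of the current point, that is, the number with its free bits as digits. -/
def keyProg : Prog :=
  accumulate Reg.coord Reg.key (.var Reg.dim) 0 (2 * .var Reg.key +
    pointBit Reg.point * .eq (.get Arr.cells (.var Reg.coord)) 2)

/-- Counts the fixed coordinates in which the current point differs from the subcube. -/
def fixedDistProg : Prog :=
  count Reg.coord Reg.fixedDist (.var Reg.dim)
    (.eq (.get Arr.cells (.var Reg.coord)) (1 - pointBit Reg.point))

/-- Computes the distance of the current point from the one stored in its bucket. -/
def pairDistProg : Prog :=
  count Reg.coord Reg.pairDist (.var Reg.dim)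
    (.eq (pointBit Reg.point) (1 - pointBit Reg.stored))

/-- Records the current and the stored point if they are distinct and at distance `d`. -/
def recordPair : Prog :=
  .ite (.eq (.var Reg.pairDist) (.var Reg.dist) * (1 - .eq (.var Reg.stored) (.var Reg.point)))
    (Reg.foundFst ≔ .var Reg.point ;; Reg.foundSnd ≔ .var Reg.stored) .skip

/-- Stores the current point in its bucket if at most `d / 2` fixed coordinates are wrong. -/
def storePoint : Prog :=
  .ite (.lt (.var Reg.dist / 2) (.var Reg.fixedDist)) .skip
    (.store Arr.table (.var Reg.key) (.var Reg.point))

/-- Processes one point: compares it with the point in its bucket, and stores it there. -/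
def pointProg : Prog :=
  keyProg ;; fixedDistProg ;; Reg.stored ≔ .get Arr.table (.var Reg.key) ;; pairDistProg ;;
  recordPair ;; storePoint

/-- One round: draws a subcube and processes all points. -/
def roundProg : Prog := drawWord ;; forLoop Reg.point (.var Reg.numPoints) pointProg

/-- The algorithm for the closest pair problem. -/
def closestPairProg : Prog :=
  setupProg ;; forLoop Reg.round (.var Reg.numRounds) roundProg ;;
  0 ≔ .var Reg.foundFst ;; 1 ≔ .var Reg.foundSnd

/-! ### Setup -/

/-- A coordinate is fixed to `0`, and likewise to `1`, with probability
`threshold m d / 2 ^ (m + 2)`, which approximates `min (d / m) (1 / 2)`. -/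
def threshold (m d : ℕ) : ℕ := min (2 ^ (m + 2) * d ⌈/⌉ m) (2 ^ (m + 1))

theorem two_mul_threshold_le (m d : ℕ) : 2 * threshold m d ≤ 2 ^ (m + 2) := by
  have : threshold m d ≤ 2 ^ (m + 1) := min_le_right _ _
  rw [pow_succ _ (m + 1)]
  omega

/-- Up to the factor `(2 ^ (m + 2)) ^ m`, a lower bound for `d + 1` times the probability of finding
the closest pair in one round; see `card_reveals_ge`. -/
def denom (m d : ℕ) : ℕ :=
  (2 * threshold m d) ^ d * (2 ^ (m + 2) - threshold m d) ^ (m - d)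

/-- As `n ≤ 2 ^ (m + 1)`, all of so many rounds fail with probability at most `1 / n ^ 2`. -/
def numRounds (m d : ℕ) : ℕ :=
  2 * ((m + 1) * (m + 1)) * (2 ^ (m + 2)) ^ m / denom m d + 1

/-- A bound for the bit lengths of all numbers that occur in the course of the algorithm. -/
def width (m : ℕ) : ℕ := (m + 5) ^ 2

section width

variable {m d v k : ℕ}

instance : NeZero (width m) := ⟨by unfold width; positivity⟩

theorem two_pow_lt_two_pow_width (hk : k ≤ m * (m + 2) + 2 * m + 5) : 2 ^ k < 2 ^ width m :=
  Nat.pow_lt_pow_right one_lt_two (by unfold width; nlinarith)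

theorem lt_two_pow_width_of_le (hv : v ≤ m + 2) : v < 2 ^ width m :=
  Nat.lt_two_pow_self.trans (two_pow_lt_two_pow_width (by nlinarith))

theorem pow_lt_two_pow_width (hv : v ≤ 2 ^ (m + 2)) (hk : k ≤ m) : v ^ k < 2 ^ width m :=
  calc v ^ k ≤ 2 ^ ((m + 2) * k) := by rw [pow_mul]; gcongr
    _ < 2 ^ width m := two_pow_lt_two_pow_width (by nlinarith)

theorem denom_le (hd : d ≤ m) : denom m d ≤ (2 ^ (m + 2)) ^ m :=
  calc denom m d ≤ (2 ^ (m + 2)) ^ d * (2 ^ (m + 2)) ^ (m - d) :=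
        Nat.mul_le_mul (Nat.pow_le_pow_left (two_mul_threshold_le m d) d)
          (Nat.pow_le_pow_left (Nat.sub_le _ _) _)
    _ = (2 ^ (m + 2)) ^ m := by rw [← pow_add, Nat.add_sub_cancel' hd]

theorem numRounds_lt (m d : ℕ) : numRounds m d < 2 ^ width m := by
  have hm : m + 1 ≤ 2 ^ m := Nat.lt_two_pow_self
  calc numRounds m d ≤ 2 * ((m + 1) * (m + 1)) * (2 ^ (m + 2)) ^ m + 1 := by
        unfold numRounds
        gcongr
        exact Nat.div_le_self _ _
    _ ≤ 2 * (2 ^ m * 2 ^ m) * (2 ^ (m + 2)) ^ m + 1 := by gcongr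
    _ = 2 ^ (m * (m + 2) + 2 * m + 1) + 1 := by rw [← pow_mul]; ring
    _ ≤ 2 ^ (m * (m + 2) + 2 * m + 2) := by
        rw [pow_succ _ (m * (m + 2) + 2 * m + 1)]
        have := Nat.one_le_two_pow (n := m * (m + 2) + 2 * m + 1)
        omega
    _ < 2 ^ width m := two_pow_lt_two_pow_width (by omega)

end width

section setup

variable {n m d : ℕ} {x : Fin n → BinWord m} {dec : Option (BinWord m → BinWord m)} {s : State}

/-- The input is in place: `numPoints`, `dim` and `dist` are in their registers and the words in
their array. -/
structure Input (x : Fin n → BinWord m) (d : ℕ) (s : State) : Prop where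
  numPoints : s.reg Reg.numPoints = n
  dim : s.reg Reg.dim = m
  dist : s.reg Reg.dist = d
  points : ∀ (i : Fin n) (k : Fin m), s.arr Arr.points (i * m + k) = (x i k).toNat

theorem Input.frame {p : Prog} {s' : State} (h : Input x d s) (hf : Frame p s s')
    (h₀ : p.keepsReg Reg.numPoints = true := by rfl) (h₁ : p.keepsReg Reg.dim = true := by rfl)
    (h₂ : p.keepsReg Reg.dist = true := by rfl) (h₃ : p.keepsArr Arr.points = true := by rfl) :
    Input x d s' :=
  ⟨(hf.reg _ h₀).trans h.numPoints, (hf.reg _ h₁).trans h.dim, (hf.reg _ h₂).trans h.dist,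
    hf.arr _ h₃ ▸ h.points⟩

theorem wp_thresholdProg (hm : 0 < m) (hd : d ≤ m) (hs : Input x d s)
    (hscale : s.reg Reg.scale = 2 ^ (m + 2)) :
    Wp dec (width m) 2 thresholdProg (fun s' => s'.reg Reg.threshold = threshold m d) s := by
  have ceil_lt : 2 ^ (m + 2) * d ⌈/⌉ m < 2 ^ width m :=
    calc 2 ^ (m + 2) * d ⌈/⌉ m ≤ 2 ^ (m + 2) := by
          rw [ceilDiv_le_iff_le_mul hm, mul_comm m]
          gcongr
      _ < 2 ^ width m := two_pow_lt_two_pow_width (by nlinarith)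
  have half : 2 ^ (m + 2) / 2 = 2 ^ (m + 1) := by rw [pow_succ]; omega
  refine .seq (.assign (v := 2 ^ (m + 2) * d ⌈/⌉ m) ?_ ceil_lt
    (.assign (v := threshold m d) ?_ ((min_le_left _ _).trans_lt ceil_lt) (by simp)))
  · simp [hscale, hs.dim, hs.dist, Nat.ceilDiv_eq_add_pred_div]
  · simp [hscale, half, threshold, tsub_tsub_eq_min]

theorem wp_numRoundsProg (hd : d ≤ m) (hs : Input x d s) (hscale : s.reg Reg.scale = 2 ^ (m + 2))
    (hthreshold : s.reg Reg.threshold = threshold m d) :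
    Wp dec (width m) (6 * m + 11) numRoundsProg (fun s' => s'.reg Reg.numRounds = numRounds m d)
      s := by
  have dim_lt : m < 2 ^ width m := lt_two_pow_width_of_le (by omega)
  refine .steps_mono (N₁ := (m * 3 + 3) + ((d * 3 + 3) + (((m - d) * 3 + 3) + (1 + 1))))
    (.seq ?_) (by omega)
  refine (Wp.power (b := .var Reg.scale) (e := .var Reg.dim) hscale hs.dim dim_lt
    fun k hk => pow_lt_two_pow_width le_rfl hk).mono fun s₁ f₁ _ htotal => .seq ?_
  have hs₁ := hs.frame f₁
  have hbase : (2 * .var Reg.threshold : Exp).eval s₁ = 2 * threshold m d := by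
    simp [f₁.reg Reg.threshold rfl, hthreshold]
  refine (Wp.power (e := .var Reg.dist) hbase hs₁.dist (by omega)
    fun k hk => pow_lt_two_pow_width (two_mul_threshold_le m d) (hk.trans hd)).mono
    fun s₂ f₂ _ hdenom => .seq ?_
  have hs₂ := hs₁.frame f₂
  have hbase' : (.var Reg.scale - .var Reg.threshold : Exp).eval s₂ =
      2 ^ (m + 2) - threshold m d := by
    simp [f₂.reg Reg.threshold rfl, f₁.reg Reg.threshold rfl, hthreshold, f₂.reg Reg.scale rfl,
      f₁.reg Reg.scale rfl, hscale]
  have hexp : (.var Reg.dim - .var Reg.dist : Exp).eval s₂ = m - d := by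
    simp [hs₂.dim, hs₂.dist]
  refine (Wp.power hbase' hexp (by omega) fun k hk => pow_lt_two_pow_width (Nat.sub_le _ _)
    (by omega)).mono fun s₃ f₃ _ hfactor => .seq ?_
  refine .assign (v := denom m d) ?_ ?_ (.assign (v := numRounds m d) ?_ (numRounds_lt m d)
    (by simp))
  · simp [f₃.reg Reg.denom rfl, hdenom, hfactor, denom]
  · exact (denom_le hd).trans_lt (pow_lt_two_pow_width le_rfl le_rfl)
  · simp [(hs₂.frame f₃).dim, f₃.reg Reg.total rfl, f₂.reg Reg.total rfl, htotal, numRounds]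

theorem wp_setupProg (hm : 0 < m) (hd : d ≤ m) (hs : Input x d s) :
    Wp dec (width m) (9 * m + 22) setupProg (fun s' =>
      s'.reg Reg.threshold = threshold m d ∧ s'.reg Reg.numRounds = numRounds m d) s := by
  have hexp : (.var Reg.dim + 2 : Exp).eval s = m + 2 := by simp [hs.dim]
  refine .steps_mono (N₁ := ((m + 2) * 3 + 3) + (2 + (6 * m + 11))) (.seq ?_) (by omega)
  refine (Wp.power (b := 2) rfl hexp (lt_two_pow_width_of_le le_rfl)
    fun k hk => two_pow_lt_two_pow_width (by nlinarith)).mono fun s₁ f₁ _ hscale => .seq ?_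
  refine (wp_thresholdProg hm hd (hs.frame f₁) hscale).mono fun s₂ f₂ _ hthreshold => ?_
  exact (wp_numRoundsProg hd ((hs.frame f₁).frame f₂) ((f₂.reg _ rfl).trans hscale)
    hthreshold).mono fun s₃ f₃ _ hrounds => ⟨(f₃.reg _ rfl).trans hthreshold, hrounds⟩

end setup

/-! ### Drawing a subcube -/

/-- The distribution of a coordinate of the random subcube, as a function of a uniformly distributed
number `u`: it is fixed to `0` and to `1` for `a` values of `u` each. -/
def cellOf (a u : ℕ) : Option Bool :=
  if u < a then some false else if u < 2 * a then some true else none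

/-- The encoding of the coordinates of a partial word in the memory. -/
def cellCode : Option Bool → ℕ
  | some b => b.toNat
  | none => 2

theorem cellCode_cellOf (a u : ℕ) : cellCode (cellOf a u) =
    2 - (if u < a then 1 else 0) - if u < 2 * a then 1 else 0 := by
  unfold cellOf
  split_ifs <;> first | rfl | omega

/-- The number with the `b`-th block of `L` bits of `ω` as its binary digits. -/
def drawn (L : ℕ) (ω : ℕ → Bool) (b : ℕ) : ℕ := bitsVal (fun l => ω (b * L + l)) L

/-- The subcube drawn in round `ρ`; its coordinate `k` is determined by the block `ρ * m + k` of
`m + 2` random bits. -/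
def roundWord (m d : ℕ) (ω : ℕ → Bool) (ρ : ℕ) : PartialWord m :=
  fun k => cellOf (threshold m d) (drawn (m + 2) ω (ρ * m + k))

/-- The tape is at the beginning of the `b`-th block of `m + 2` bits of `ω`. -/
def TapeAt (m : ℕ) (ω : ℕ → Bool) (b : ℕ) (s : State) : Prop :=
  s.tape = fun l => ω (b * (m + 2) + l)

/-- The partial word `σ` is stored in the memory. -/
def HoldsWord {m : ℕ} (σ : PartialWord m) (s : State) : Prop :=
  ∀ k : Fin m, s.arr Arr.cells k = cellCode (σ k)

section draw

variable {m d b ρ : ℕ} {dec : Option (BinWord m → BinWord m)} {s : State} {ω : ℕ → Bool}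

@[simp] theorem tapeAt_setReg {r v : ℕ} : TapeAt m ω b (s.setReg r v) ↔ TapeAt m ω b s := Iff.rfl

theorem wp_drawNumber (hdim : s.reg Reg.dim = m) (htape : TapeAt m ω b s) :
    Wp dec (width m) (4 * m + 11) drawNumber
      (fun s' => s'.reg Reg.draw = drawn (m + 2) ω b ∧ TapeAt m ω (b + 1) s') s := by
  let bits : ℕ → Bool := fun l => ω (b * (m + 2) + l)
  have loop := Wp.forLoop (dec := dec) (W := width m) (N := 2) (c := Reg.bit) (K := m + 2)
    (bnd := .var Reg.dim + 2)
    (body := .flip Reg.coin ;; Reg.draw ≔ 2 * .var Reg.draw + .var Reg.coin)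
    (s := s.setReg Reg.draw 0)
    (fun k s' => s'.reg Reg.draw = bitsVal bits k ∧ s'.tape = fun l => bits (k + l))
    (by simp [hdim]) (lt_two_pow_width_of_le le_rfl) (by simp [bitsVal, bits, htape.symm])
    (fun k hk s' _ _ h => .seq (.flip (.assign (v := bitsVal bits (k + 1)) ?_ ?_ ?_)))
  · refine .steps_mono (.seq (.assign (v := 0) rfl (by positivity)
      (loop.mono fun s' _ _ h => ⟨h.1, h.2.trans (funext fun l => ?_)⟩))) (by omega)
    exact congrArg ω (by ring)
  · simp [h.1, h.2, bitsVal]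
  · exact (bitsVal_lt _ _).trans_le (two_pow_lt_two_pow_width (by nlinarith)).le
  · refine ⟨by simp, ?_⟩
    simp only [State.setReg_tape, State.flipInto_tape, h.2]
    exact funext fun l => congrArg bits (by ring)

theorem wp_drawWord (hdim : s.reg Reg.dim = m) (hthreshold : s.reg Reg.threshold = threshold m d)
    (htape : TapeAt m ω (ρ * m) s) :
    Wp dec (width m) (m * (4 * m + 14) + 2) drawWord
      (fun s' => HoldsWord (roundWord m d ω ρ) s' ∧ TapeAt m ω ((ρ + 1) * m) s') s := by
  refine (Wp.forLoop (N := 4 * m + 11 + 1) (bnd := .var Reg.dim) (fun k s' =>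
      (∀ l : Fin m, (l : ℕ) < k → s'.arr Arr.cells l = cellCode (roundWord m d ω ρ l)) ∧
        TapeAt m ω (ρ * m + k) s')
    hdim (lt_two_pow_width_of_le (by omega)) ⟨fun l hl => absurd hl (Nat.not_lt_zero l), htape⟩
    fun k hk s₁ f₁ hc h => .seq ?_).mono fun s' _ _ h =>
      ⟨fun l => h.1 l l.is_lt, by rw [add_one_mul]; exact h.2⟩
  refine (wp_drawNumber ((f₁.reg _ rfl).trans hdim) h.2).mono fun s₂ f₂ _ ⟨hdraw, htape₂⟩ => ?_
  have hcoord : (Exp.var Reg.coord).eval s₂ = k := (f₂.reg _ rfl).trans hc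
  have hcell : (2 - .lt (.var Reg.draw) (.var Reg.threshold) -
      .lt (.var Reg.draw) (2 * .var Reg.threshold) : Exp).eval s₂ =
      cellCode (roundWord m d ω ρ ⟨k, hk⟩) := by
    simp [hdraw, f₂.reg Reg.threshold rfl, f₁.reg Reg.threshold rfl, hthreshold, roundWord,
      cellCode_cellOf]
  refine .store hcoord hcell ?_ ⟨fun l hl => ?_, htape₂⟩
  · exact lt_two_pow_width_of_le (by rw [roundWord, cellCode_cellOf]; omega)
  · obtain hl | rfl := Nat.lt_succ_iff_lt_or_eq.1 hl
    · simpa [hl.ne, f₂.arr Arr.cells rfl] using h.1 l hl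
    · simp

end draw

/-! ### Visiting a point -/

section visit

variable {n m d : ℕ} {x : Fin n → BinWord m} {dec : Option (BinWord m → BinWord m)} {s : State}
  {σ : PartialWord m} {p q : Fin n} {M : Memory n}

/-- The state in which the algorithm visits the point `p`. -/
structure AtPoint (x : Fin n → BinWord m) (d : ℕ) (σ : PartialWord m) (p : Fin n) (s : State) :
    Prop extends Input x d s where
  cells : HoldsWord σ s
  point : s.reg Reg.point = p

theorem AtPoint.frame {prog : Prog} {s' : State} (h : AtPoint x d σ p s) (hf : Frame prog s s')
    (h₀ : prog.keepsReg Reg.numPoints = true := by rfl)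
    (h₁ : prog.keepsReg Reg.dim = true := by rfl) (h₂ : prog.keepsReg Reg.dist = true := by rfl)
    (h₃ : prog.keepsReg Reg.point = true := by rfl)
    (h₄ : prog.keepsArr Arr.points = true := by rfl)
    (h₅ : prog.keepsArr Arr.cells = true := by rfl) : AtPoint x d σ p s' :=
  ⟨h.toInput.frame hf h₀ h₁ h₂ h₄, fun k => hf.arr _ h₅ ▸ h.cells k, (hf.reg _ h₃).trans h.point⟩

/-- The memory `M` is stored in the state `s`. -/
structure Represents (M : Memory n) (s : State) : Prop where
  table : ∀ k, s.arr Arr.table k = M.table k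
  fst : s.reg Reg.foundFst = M.pair.1
  snd : s.reg Reg.foundSnd = M.pair.2

theorem Represents.frame {prog : Prog} {s' : State} (h : Represents M s) (hf : Frame prog s s')
    (h₁ : prog.keepsReg Reg.foundFst = true := by rfl)
    (h₂ : prog.keepsReg Reg.foundSnd = true := by rfl)
    (h₃ : prog.keepsArr Arr.table = true := by rfl) : Represents M s' :=
  ⟨fun k => hf.arr _ h₃ ▸ h.table k, (hf.reg _ h₁).trans h.fst, (hf.reg _ h₂).trans h.snd⟩

@[simp] theorem represents_setReg {r v : ℕ} (h₁ : Reg.foundFst ≠ r) (h₂ : Reg.foundSnd ≠ r) :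
    Represents M (s.setReg r v) ↔ Represents M s := by
  have hfst : (s.setReg r v).reg Reg.foundFst = s.reg Reg.foundFst :=
    (State.setReg_reg ..).trans (if_neg h₁)
  have hsnd : (s.setReg r v).reg Reg.foundSnd = s.reg Reg.foundSnd :=
    (State.setReg_reg ..).trans (if_neg h₂)
  exact ⟨fun h => ⟨h.table, hfst ▸ h.fst, hsnd ▸ h.snd⟩,
    fun h => ⟨h.table, hfst ▸ h.fst, hsnd ▸ h.snd⟩⟩

theorem eval_pointBit {r : ℕ} {k : Fin m} (hs : Input x d s) (hr : s.reg r = p)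
    (hk : s.reg Reg.coord = k) : (pointBit r).eval s = (x p k).toNat := by
  simp only [Exp.eval_get, Exp.eval_add, Exp.eval_mul, Exp.eval_var, hr, hs.dim, hk, hs.points]

theorem cellCode_eq_two {o : Option Bool} : cellCode o = 2 ↔ o = none := by
  rcases o with _ | _ | _ <;> decide

theorem cellCode_eq_one_sub {o : Option Bool} {b : Bool} :
    cellCode o = 1 - b.toNat ↔ o = some !b := by
  rcases o with _ | _ | _ <;> cases b <;> decide

theorem wp_keyProg (hs : AtPoint x d σ p s) :
    Wp dec (width m) (m * 3 + 3) keyProg (fun s' => s'.reg Reg.key = bucket σ (x p)) s := by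
  let free : BinWord m := fun k => x p k && (σ k).isNone
  refine Wp.accumulate (f := bitsVal (digits free)) hs.dim (lt_two_pow_width_of_le (by omega)) rfl
    (fun k hk => (bitsVal_lt _ _).trans (two_pow_lt_two_pow_width (by nlinarith)))
    fun k hk s' hf hcoord hkey => ?_
  have hs' := hs.frame hf
  have hbit : (x p ⟨k, hk⟩).toNat * (if cellCode (σ ⟨k, hk⟩) = 2 then 1 else 0) =
      (digits free k).toNat := by
    rw [digits_val free ⟨k, hk⟩]
    cases hσ : σ ⟨k, hk⟩ <;> simp [free, hσ, cellCode_eq_two]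
  rw [bitsVal, ← hbit, ← eval_pointBit (k := ⟨k, hk⟩) hs'.toInput hs'.point hcoord,
    ← hs'.cells ⟨k, hk⟩]
  simp [hkey, hcoord]

theorem wp_fixedDistProg (hs : AtPoint x d σ p s) :
    Wp dec (width m) (m * 3 + 3) fixedDistProg
      (fun s' => s'.reg Reg.fixedDist = fixedDist σ (x p)) s := by
  refine Wp.count hs.dim (lt_two_pow_width_of_le (by omega)) fun k s' hf hcoord => ?_
  have hs' := hs.frame hf
  rw [Exp.eval_eq, Exp.eval_sub, eval_pointBit hs'.toInput hs'.point hcoord]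
  simp only [Exp.eval_get, Exp.eval_var, hcoord, hs'.cells k, Exp.eval_ofNat, cellCode_eq_one_sub]

theorem wp_pairDistProg (hs : AtPoint x d σ p s) (hq : s.reg Reg.stored = q) :
    Wp dec (width m) (m * 3 + 3) pairDistProg
      (fun s' => s'.reg Reg.pairDist = hammingDist (x p) (x q)) s := by
  refine Wp.count hs.dim (lt_two_pow_width_of_le (by omega)) fun k s' hf hcoord => ?_
  have hs' := hs.frame hf
  rw [Exp.eval_eq, Exp.eval_sub, eval_pointBit hs'.toInput hs'.point hcoord,
    eval_pointBit hs'.toInput ((hf.reg _ rfl).trans hq) hcoord]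
  cases x p k <;> cases x q k <;> simp

theorem wp_recordPair (hs : AtPoint x d σ p s) (hM : Represents M s) (hn : n < 2 ^ width m)
    (hstored : s.reg Reg.stored = M.table (bucket σ (x p)))
    (hdist : s.reg Reg.pairDist = hammingDist (x p) (x (M.table (bucket σ (x p))))) :
    Wp dec (width m) 3 recordPair (fun s' => s'.reg Reg.foundFst = (M.visit x d σ p).pair.1 ∧
      s'.reg Reg.foundSnd = (M.visit x d σ p).pair.2) s := by
  have hguard : (.eq (.var Reg.pairDist) (.var Reg.dist) *
      (1 - .eq (.var Reg.stored) (.var Reg.point)) : Exp).eval s ≠ 0 ↔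
      hammingDist (x p) (x (M.table (bucket σ (x p)))) = d ∧ M.table (bucket σ (x p)) ≠ p := by
    simp [hstored, hdist, hs.dist, hs.point, Fin.val_inj, Nat.sub_eq_zero_iff_le]
  rw [Memory.pair_visit]
  refine .ite (N := 1 + 1) (fun h => ?_) fun h => ?_
  · rw [if_pos (hguard.1 h)]
    refine .seq (.assign hs.point (p.is_lt.trans hn) (.assign (v := M.table (bucket σ (x p))) ?_
      ((M.table _).is_lt.trans hn) ?_)) <;> simp [hstored]
  · rw [if_neg fun hfound => hguard.2 hfound h]
    exact .steps_mono (.skip ⟨hM.fst, hM.snd⟩) one_le_two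

theorem wp_storePoint (hs : AtPoint x d σ p s) (hn : n < 2 ^ width m)
    (htable : ∀ k, s.arr Arr.table k = M.table k) (hkey : s.reg Reg.key = bucket σ (x p))
    (hdist : s.reg Reg.fixedDist = fixedDist σ (x p)) :
    Wp dec (width m) 2 storePoint (fun s' => ∀ k, s'.arr Arr.table k = (M.visit x d σ p).table k)
      s := by
  have hguard : (Exp.lt (.var Reg.dist / 2) (.var Reg.fixedDist)).eval s = 0 ↔
      fixedDist σ (x p) ≤ d / 2 := by
    simp [hs.dist, hdist]
  rw [Memory.table_visit]
  refine .ite (N := 1) (fun h => ?_) fun h => ?_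
  · rw [if_neg (mt hguard.2 h)]
    exact .skip htable
  · rw [if_pos (hguard.1 h)]
    refine .store hkey hs.point (p.is_lt.trans hn) fun k => ?_
    obtain rfl | hk := eq_or_ne k (bucket σ (x p)) <;> simp [*]

theorem wp_pointProg (hs : AtPoint x d σ p s) (hM : Represents M s) (hn : n < 2 ^ width m) :
    Wp dec (width m) (9 * m + 15) pointProg (Represents (M.visit x d σ p)) s := by
  refine .steps_mono (N₁ := (m * 3 + 3) + ((m * 3 + 3) + (1 + ((m * 3 + 3) + (3 + 2)))))
    (.seq ?_) (by omega)
  refine (wp_keyProg hs).mono fun s₁ f₁ _ hkey => .seq ?_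
  have hs₁ := hs.frame f₁
  refine (wp_fixedDistProg hs₁).mono fun s₂ f₂ _ hfixed => .seq ?_
  have hs₂ := hs₁.frame f₂
  have hM₂ := (hM.frame f₁).frame f₂
  have hkey₂ : s₂.reg Reg.key = bucket σ (x p) := (f₂.reg _ rfl).trans hkey
  have hstored : (Exp.get Arr.table (.var Reg.key)).eval s₂ = M.table (bucket σ (x p)) := by
    rw [Exp.eval_get, Exp.eval_var, hkey₂, hM₂.table]
  have f₃ := hstored ▸ Frame.assign Reg.stored (.get Arr.table (.var Reg.key)) s₂
  refine .assign hstored ((M.table _).is_lt.trans hn) (.seq ?_)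
  have hs₃ := hs₂.frame f₃
  refine (wp_pairDistProg (q := M.table (bucket σ (x p))) hs₃ (by simp)).mono
    fun s₄ f₄ _ hdist => .seq ?_
  have hs₄ := hs₃.frame f₄
  have hM₄ := (hM₂.frame f₃).frame f₄
  have hstored₄ : s₄.reg Reg.stored = M.table (bucket σ (x p)) := by simp [f₄.reg Reg.stored rfl]
  refine (wp_recordPair hs₄ hM₄ hn hstored₄ hdist).mono fun s₅ f₅ _ hpair => ?_
  refine (wp_storePoint (hs₄.frame f₅) hn (fun k => f₅.arr Arr.table rfl ▸ hM₄.table k) ?_ ?_).mono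
    fun s₆ f₆ _ htable => ⟨htable, (f₆.reg _ rfl).trans hpair.1, (f₆.reg _ rfl).trans hpair.2⟩
  · rw [f₅.reg Reg.key rfl, f₄.reg Reg.key rfl, f₃.reg Reg.key rfl, hkey₂]
  · rw [f₅.reg Reg.fixedDist rfl, f₄.reg Reg.fixedDist rfl, f₃.reg Reg.fixedDist rfl, hfixed]

end visit

/-! ### The whole algorithm -/

section algorithm

variable {n m d ρ : ℕ} {x : Fin n → BinWord m} {i j : Fin n}
  {dec : Option (BinWord m → BinWord m)} {s : State} {σ : PartialWord m} {M₀ : Memory n}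
  {ω : ℕ → Bool}

theorem wp_scan (h : IsUniqueClosestPair x i j d) (hij : i < j) (hn : n < 2 ^ width m)
    (hs : Input x d s) (hσ : HoldsWord σ s) (hM₀ : Represents M₀ s) :
    Wp dec (width m) (n * (9 * m + 17) + 2) (forLoop Reg.point (.var Reg.numPoints) pointProg)
      (fun s' => ∃ M, ScanInvariant x i j d σ M₀ M n ∧ Represents M s') s := by
  refine .forLoop (N := 9 * m + 15) (bnd := .var Reg.numPoints)
    (fun k s' => ∃ M, ScanInvariant x i j d σ M₀ M k ∧ Represents M s') hs.numPoints hn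
    ⟨M₀, .zero M₀, hM₀⟩ fun k hk s' hf hpoint ⟨M, hM, hrep⟩ => ?_
  have hs' : AtPoint x d σ ⟨k, hk⟩ s' := ⟨hs.frame hf, fun l => hf.arr Arr.cells rfl ▸ hσ l, hpoint⟩
  exact (wp_pointProg hs' hrep hn).mono fun s'' _ _ hrep' =>
    ⟨_, hM.succ (p := ⟨k, hk⟩) h hij, hrep'⟩

/-- The number of elementary steps of one round. -/
def roundSteps (n m : ℕ) : ℕ := m * (4 * m + 14) + 2 + (n * (9 * m + 17) + 2)

theorem wp_roundProg (h : IsUniqueClosestPair x i j d) (hij : i < j) (hn : n < 2 ^ width m)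
    (hs : Input x d s) (hthreshold : s.reg Reg.threshold = threshold m d)
    (htape : TapeAt m ω (ρ * m) s) (hM₀ : Represents M₀ s) :
    Wp dec (width m) (roundSteps n m) roundProg (fun s' => TapeAt m ω ((ρ + 1) * m) s' ∧
      ∃ M, ScanInvariant x i j d (roundWord m d ω ρ) M₀ M n ∧ Represents M s') s := by
  refine .seq ((wp_drawWord hs.dim hthreshold htape).mono fun s₁ f₁ _ ⟨hσ, htape₁⟩ => ?_)
  exact (wp_scan h hij hn (hs.frame f₁) hσ (hM₀.frame f₁)).mono fun s₂ f₂ _ hM =>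
    ⟨(f₂.tape rfl).trans htape₁, hM⟩

/-- Some round reveals the pair `y, y'`. -/
def Success (d : ℕ) (y y' : BinWord m) (ω : ℕ → Bool) : Prop :=
  ∃ ρ < numRounds m d, Reveals (roundWord m d ω ρ) d y y'

/-- The number of elementary steps of the algorithm. -/
def numSteps (n m d : ℕ) : ℕ :=
  9 * m + 22 + (numRounds m d * (roundSteps n m + 2) + 2 + 2)

theorem wp_rounds (h : IsUniqueClosestPair x i j d) (hij : i < j) (hn : n < 2 ^ width m)
    (hs : Input x d s) (hthreshold : s.reg Reg.threshold = threshold m d)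
    (hrounds : s.reg Reg.numRounds = numRounds m d) (htape : s.tape = ω) (hM₀ : Represents M₀ s) :
    Wp dec (width m) (numRounds m d * (roundSteps n m + 2) + 2)
      (forLoop Reg.round (.var Reg.numRounds) roundProg)
      (fun s' => ∃ M : Memory n, Represents M s' ∧ (Success d (x i) (x j) ω → M.Found i j)) s := by
  refine (Wp.forLoop (bnd := .var Reg.numRounds) (fun ρ s' => TapeAt m ω (ρ * m) s' ∧
    ∃ M : Memory n, Represents M s' ∧
      ((∃ ρ' < ρ, Reveals (roundWord m d ω ρ') d (x i) (x j)) → M.Found i j)) hrounds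
    (numRounds_lt m d) ⟨by simp [TapeAt, htape], M₀, hM₀, by simp⟩ ?_).mono
      fun s' _ _ h => h.2
  rintro ρ - s₁ f₁ - ⟨htape₁, M, hM, hfound⟩
  refine (wp_roundProg h hij hn (hs.frame f₁) ((f₁.reg _ rfl).trans hthreshold) htape₁ hM).mono ?_
  rintro s₂ - - ⟨htape₂, M', hscan, hM'⟩
  refine ⟨htape₂, M', hM', fun ⟨ρ', hρ', hreveals⟩ => ?_⟩
  obtain hρ' | rfl := Nat.lt_succ_iff_lt_or_eq.1 hρ'
  · exact hscan.found_of_found (hfound ⟨ρ', hρ', hreveals⟩)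
  · exact hscan.found hreveals j.is_lt

theorem wp_closestPairProg (h : IsUniqueClosestPair x i j d) (hij : i < j) (hm : 0 < m)
    (hn : n < 2 ^ width m) (hs : Input x d s) (htape : s.tape = ω) (hM₀ : Represents M₀ s) :
    Wp dec (width m) (numSteps n m d) closestPairProg
      (fun s' => Success d (x i) (x j) ω → s(s'.reg 0, s'.reg 1) = s((i : ℕ), (j : ℕ))) s := by
  refine .seq ((wp_setupProg hm h.le_dim hs).mono fun s₁ f₁ _ ⟨hthreshold, hrounds⟩ => .seq ?_)
  refine (wp_rounds h hij hn (hs.frame f₁) hthreshold hrounds ((f₁.tape rfl).trans htape)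
    (hM₀.frame f₁)).mono fun s₂ _ _ ⟨M, hM, hfound⟩ => ?_
  refine .seq (.assign (e := .var Reg.foundFst) hM.fst (M.pair.1.is_lt.trans hn)
    (.assign (v := M.pair.2) ?_ (M.pair.2.is_lt.trans hn) fun hsuccess => ?_))
  · simp [hM.snd]
  · simpa [Memory.Found] using congrArg (Sym2.map Fin.val) (hfound hsuccess)

theorem initState_points (x : Fin n → BinWord m) (d : ℕ) (ω : ℕ → Bool) (a : Fin n) (k : Fin m) :
    (initState x d ω).arr Arr.points (a * m + k) = (x a k).toNat := by
  have hcell : (finProdFinEquiv (a, k) : ℕ) = a * m + k := by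
    rw [finProdFinEquiv_apply_val, add_comm, mul_comm]
  simp only [initState, if_true, ← hcell, Fin.is_lt, dite_true, Fin.eta, Equiv.symm_apply_apply]

theorem initState_bounded (hn : n < 2 ^ width m) (hd : d ≤ m) :
    Bounded (width m) (initState x d ω) := by
  have zero_lt : 0 < 2 ^ width m := by positivity
  constructor
  · intro r
    simp only [initState]
    split_ifs
    exacts [hn, lt_two_pow_width_of_le (by omega), lt_two_pow_width_of_le (by omega), zero_lt]
  · intro a k
    simp only [initState]
    split_ifs
    exacts [lt_two_pow_width_of_le ((Bool.toNat_le _).trans (by omega)), zero_lt, zero_lt]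

theorem exists_exec_closestPairProg (dec : Option (BinWord m → BinWord m))
    (h : IsUniqueClosestPair x i j d) (hij : i < j) (hm : 0 < m) (ω : ℕ → Bool) :
    ∃ t f, Exec dec closestPairProg (initState x d ω) t f ∧
      t ≤ numSteps n m d * unitCost (width m) ∧
      (Success d (x i) (x j) ω → s(f.reg 0, f.reg 1) = s((i : ℕ), (j : ℕ))) := by
  have hn : n < 2 ^ width m := h.card_le.trans_lt (two_pow_lt_two_pow_width (by nlinarith))
  have hinput : Input x d (initState x d ω) := ⟨rfl, rfl, rfl, initState_points x d ω⟩
  have : NeZero n := ⟨(i.pos).ne'⟩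
  have hmemory : Represents (n := n) ⟨fun _ => 0, 0, 0⟩ (initState x d ω) :=
    ⟨fun _ => rfl, rfl, rfl⟩
  obtain ⟨t, f, hexec, ht, -, hfound⟩ := wp_closestPairProg (dec := dec) h hij hm hn hinput rfl
    hmemory (initState_bounded hn h.le_dim)
  exact ⟨t, f, hexec, ht, hfound⟩

end algorithm

/-! ### The probability of revealing the closest pair -/

section card

variable {m d a N : ℕ} {y y' : BinWord m} {T : Finset (Fin m)}

theorem cellOf_eq_some_iff {u : ℕ} {b : Bool} :
    cellOf a u = some b ↔ u ∈ Finset.Ico (b.toNat * a) ((b.toNat + 1) * a) := by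
  unfold cellOf
  cases b <;> split_ifs <;> simp <;> omega

theorem card_cellOf_eq (ha : 2 * a ≤ N) (b : Bool) :
    Finset.card {u : Fin N | cellOf a u = some b} = a := by
  have hle : (b.toNat + 1) * a ≤ N :=
    (Nat.mul_le_mul_right a (Nat.succ_le_succ b.toNat_le)).trans ha
  have hfilter : (Finset.range N).filter (fun u => cellOf a u = some b) =
      Finset.Ico (b.toNat * a) ((b.toNat + 1) * a) := by
    ext u
    rw [Finset.mem_filter, Finset.mem_range, cellOf_eq_some_iff, and_iff_right_iff_imp]
    exact fun hu => (Finset.mem_Ico.1 hu).2.trans_le hle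
  rw [Finset.card_filter, Fin.sum_univ_eq_sum_range fun u => if cellOf a u = some b then 1 else 0,
    ← Finset.card_filter, hfilter, Nat.card_Ico, add_one_mul, Nat.add_sub_cancel_left]

theorem card_cellOf_ne (ha : 2 * a ≤ N) (b : Bool) :
    Finset.card {u : Fin N | cellOf a u ≠ some b} = N - a := by
  rw [← Finset.compl_filter, Finset.card_compl, card_cellOf_eq ha, Fintype.card_fin]

/-- The draws that fix all coordinates in which `y` and `y'` differ, to the value of `y'` on `T` and
to the value of `y` outside `T`, and none of the other coordinates to the wrong value. -/
def revealingBox (N a : ℕ) (y y' : BinWord m) (T : Finset (Fin m)) : Finset (Fin m → Fin N) :=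
  Fintype.piFinset fun k => if y k ≠ y' k
    then ({u | cellOf a u = some (if k ∈ T then !y k else y k)} : Finset (Fin N))
    else ({u | cellOf a u ≠ some (!y k)} : Finset (Fin N))

theorem card_revealingBox (ha : 2 * a ≤ N) (hd : hammingDist y y' = d) :
    (revealingBox N a y y' T).card = a ^ d * (N - a) ^ (m - d) := by
  have hcard (k : Fin m) : (if y k ≠ y' k
      then ({u | cellOf a u = some (if k ∈ T then !y k else y k)} : Finset (Fin N))
      else ({u | cellOf a u ≠ some (!y k)} : Finset (Fin N))).card =
        if y k ≠ y' k then a else N - a := by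
    split_ifs
    exacts [card_cellOf_eq ha _, card_cellOf_eq ha _, card_cellOf_ne ha _]
  have hcompl : Finset.card {k | ¬y k ≠ y' k} = m - d := by
    rw [← Finset.compl_filter, Finset.card_compl, Fintype.card_fin, ← hd, hammingDist]
  rw [revealingBox, Fintype.card_piFinset, Finset.prod_congr rfl fun k _ => hcard k,
    Finset.prod_ite, Finset.prod_const, Finset.prod_const, hcompl, ← hd, hammingDist]

theorem reveals_of_mem_revealingBox (hT : T ⊆ ({k | y k ≠ y' k} : Finset (Fin m)))
    {u : Fin m → Fin N} (hu : u ∈ revealingBox N a y y' T) :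
    ({k | cellOf a (u k) = some (!y k)} : Finset (Fin m)) = T ∧
      bucket (fun k => cellOf a (u k)) y = bucket (fun k => cellOf a (u k)) y' := by
  rw [revealingBox, Fintype.mem_piFinset] at hu
  constructor
  · ext k
    have := hu k
    rw [Finset.mem_filter_univ]
    split_ifs at this with hk hkT
    · exact iff_of_true ((Finset.mem_filter.1 this).2) hkT
    · rw [(Finset.mem_filter.1 this).2]
      simpa using hkT
    · exact iff_of_false (Finset.mem_filter.1 this).2 fun hkT => hk (Finset.mem_filter.1 (hT hkT)).2
  · refine bucket_eq_iff.2 fun k hfree => by_contra fun hk => ?_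
    have := hu k
    rw [if_pos hk, Finset.mem_filter_univ, hfree] at this
    exact absurd this (Option.some_ne_none _).symm

theorem two_pow_le_mul_choose (d : ℕ) : 2 ^ d ≤ (d + 1) * d.choose (d / 2) := by
  rw [← Nat.sum_range_choose]
  refine (Finset.sum_le_card_nsmul _ _ _ fun k _ => Nat.choose_le_middle k d).trans_eq ?_
  rw [Finset.card_range, smul_eq_mul]

open Classical in
theorem card_reveals_ge (ha : 2 * a ≤ N) (hd : hammingDist y y' = d) :
    (2 * a) ^ d * (N - a) ^ (m - d) ≤
      (d + 1) * Finset.card {u : Fin m → Fin N | Reveals (fun k => cellOf a (u k)) d y y'} := by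
  let wrong (u : Fin m → Fin N) : Finset (Fin m) := {k | cellOf a (u k) = some (!y k)}
  let revealing : Finset (Fin m → Fin N) := {u | Reveals (fun k => cellOf a (u k)) d y y'}
  let halves := Finset.powersetCard (d / 2) ({k | y k ≠ y' k} : Finset (Fin m))
  have hbox : ∀ T ∈ halves, a ^ d * (N - a) ^ (m - d) ≤ (revealing.filter (wrong · = T)).card := by
    intro T hT
    obtain ⟨hTsub, hTcard⟩ := Finset.mem_powersetCard.1 hT
    rw [← card_revealingBox (T := T) ha hd]
    refine Finset.card_le_card fun u hu => ?_
    obtain ⟨hwrong, hbucket⟩ := reveals_of_mem_revealingBox hTsub hu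
    refine Finset.mem_filter.2 ⟨(Finset.mem_filter_univ _).2 ⟨?_, hbucket⟩, hwrong⟩
    rw [fixedDist, hwrong, hTcard]
  have hhalves : halves.card = d.choose (d / 2) := by
    rw [Finset.card_powersetCard, ← hd, hammingDist]
  calc (2 * a) ^ d * (N - a) ^ (m - d) = 2 ^ d * (a ^ d * (N - a) ^ (m - d)) := by
        rw [mul_pow, mul_assoc]
    _ ≤ (d + 1) * d.choose (d / 2) * (a ^ d * (N - a) ^ (m - d)) := by
        gcongr
        exact two_pow_le_mul_choose d
    _ = (d + 1) * (halves.card • (a ^ d * (N - a) ^ (m - d))) := by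
        rw [hhalves, smul_eq_mul, mul_assoc]
    _ ≤ (d + 1) * ∑ T ∈ halves, (revealing.filter (wrong · = T)).card := by
        gcongr
        exact Finset.card_nsmul_le_sum _ _ _ hbox
    _ ≤ (d + 1) * revealing.card := by
        gcongr
        rw [Finset.sum_card_fiberwise_eq_card_filter]
        exact Finset.card_filter_le _ _

end card

open MeasureTheory

section fairBits

variable {ι : Type*} {e : ι → ℕ} {m L : ℕ}

theorem mul_add_injective (he : Function.Injective e) :
    Function.Injective fun t : ι × Fin L => e t.1 * L + t.2 := by
  rintro ⟨t, l⟩ ⟨t', l'⟩ h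
  have : NeZero L := ⟨l.pos.ne'⟩
  have := Nat.divModEquiv L |>.symm.injective (a₁ := (e t, l)) (a₂ := (e t', l')) h
  simpa [he.eq_iff] using this

variable [Fintype ι]

instance : IsProbabilityMeasure fairBits := inferInstanceAs (IsProbabilityMeasure
  (Measure.infinitePi fun _ : ℕ => (PMF.uniformOfFintype Bool).toMeasure))

theorem fairBits_cylinder (he : Function.Injective e) (b : ι → Bool) :
    fairBits.real {ω | (fun t => ω (e t)) = b} = (1 / 2) ^ Fintype.card ι := by
  classical
  have hset : {ω : ℕ → Bool | (fun t => ω (e t)) = b} = Set.pi (Finset.univ.image e : Finset ℕ)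
      fun k => {Function.extend e b (fun _ => false) k} := by
    ext ω
    simp [Set.mem_pi, he.extend_apply, funext_iff]
  rw [Measure.real, hset, fairBits, Measure.infinitePi_pi _ (fun _ _ => MeasurableSet.singleton _),
    Finset.prod_image fun _ _ _ _ h => he h]
  simp

theorem fairBits_mem (he : Function.Injective e) (B : Finset (ι → Bool)) :
    fairBits.real {ω | (fun t => ω (e t)) ∈ B} = B.card / 2 ^ Fintype.card ι := by
  have hmeas : Measurable fun (ω : ℕ → Bool) t => ω (e t) := by fun_prop
  calc fairBits.real ((fun ω t => ω (e t)) ⁻¹' B)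
      = ∑ b ∈ B, (fairBits.map fun ω t => ω (e t)).real {b} := by
        rw [sum_measureReal_singleton, map_measureReal_apply hmeas B.measurableSet]
    _ = ∑ _b ∈ B, (1 / 2) ^ Fintype.card ι := by
        refine Finset.sum_congr rfl fun b _ => ?_
        rw [map_measureReal_apply hmeas (MeasurableSet.singleton b), ← fairBits_cylinder he b]
        rfl
    _ = B.card / 2 ^ Fintype.card ι := by
        rw [Finset.sum_const, nsmul_eq_mul, one_div_pow, mul_one_div]

/-- Words of length `L` as binary numbers. -/
noncomputable def wordEquiv (L : ℕ) : BinWord L ≃ Fin (2 ^ L) :=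
  Equiv.ofBijective (fun y => ⟨wordVal y, bitsVal_lt _ _⟩)
    ((Fintype.bijective_iff_injective_and_card _).2
      ⟨fun _ _ h => wordVal_injective (Fin.mk.inj h), by simp⟩)

theorem wordEquiv_block (ω : ℕ → Bool) (b : ℕ) :
    (wordEquiv L fun l : Fin L => ω (b * L + l) : ℕ) = drawn L ω b :=
  wordVal_eq_bitsVal fun l => ω (b * L + l)

theorem fairBits_drawn (he : Function.Injective e) (B : Finset (ι → Fin (2 ^ L))) :
    fairBits.real {ω | (fun t => wordEquiv L fun l => ω (e t * L + l)) ∈ B} =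
      B.card / (2 ^ L) ^ Fintype.card ι := by
  let numbers : (ι × Fin L → Bool) ≃ (ι → Fin (2 ^ L)) :=
    (Equiv.curry _ _ _).trans (Equiv.piCongrRight fun _ => wordEquiv L)
  have h := fairBits_mem (mul_add_injective (L := L) he) (B.map numbers.symm.toEmbedding)
  simp only [Finset.mem_map_equiv, Equiv.symm_symm, Finset.card_map, Fintype.card_prod,
    Fintype.card_fin, mul_comm (Fintype.card ι), pow_mul] at h
  exact h

theorem fairBits_forall_drawn (R : ℕ) (B : Finset (Fin m → Fin (2 ^ L))) :
    fairBits.real {ω | ∀ ρ : Fin R, (fun k : Fin m =>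
      wordEquiv L fun l => ω ((ρ * m + k) * L + l)) ∈ B} = (B.card / (2 ^ L) ^ m) ^ R := by
  have h := fairBits_drawn (mul_add_injective Fin.val_injective)
    ((Fintype.piFinset fun _ : Fin R => B).map
      (Equiv.curry (Fin R) (Fin m) (Fin (2 ^ L))).symm.toEmbedding)
  simp only [Finset.mem_map_equiv, Equiv.symm_symm, Finset.card_map, Fintype.mem_piFinset,
    Fintype.card_piFinset_const, Fintype.card_prod, Fintype.card_fin, mul_comm R, pow_mul,
    Nat.cast_pow, ← div_pow] at h
  exact h

end fairBits

section failure

variable {n m d : ℕ} {y y' : BinWord m}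

theorem threshold_pos (hm : 0 < m) (hd : 0 < d) : 0 < threshold m d := by
  refine lt_min (Nat.pos_of_ne_zero fun h => ?_) (by positivity)
  have := (ceilDiv_le_iff_le_mul (b := 2 ^ (m + 2) * d) hm).1 h.le
  rw [mul_zero, Nat.le_zero] at this
  exact (by positivity : 2 ^ (m + 2) * d ≠ 0) this

theorem denom_pos (hd : d ≤ m) : 0 < denom m d := by
  have hlt : threshold m d < 2 ^ (m + 2) :=
    (min_le_right _ _).trans_lt (Nat.pow_lt_pow_right one_lt_two (by omega))
  refine Nat.mul_pos ?_ (pow_pos (Nat.sub_pos_of_lt hlt) _)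
  obtain rfl | hd0 := d.eq_zero_or_pos
  · exact one_pos
  · exact pow_pos (Nat.mul_pos two_pos (threshold_pos (hd0.trans_le hd) hd0)) d

open Classical in
/-- The probability that one round reveals the pair `y`, `y'`. -/
noncomputable def revealProb (d : ℕ) (y y' : BinWord m) : ℝ :=
  Finset.card {u : Fin m → Fin (2 ^ (m + 2)) |
    Reveals (fun k => cellOf (threshold m d) (u k)) d y y'} / (2 ^ (m + 2)) ^ m

theorem fairBits_not_success :
    fairBits.real {ω | ¬Success d y y' ω} = (1 - revealProb d y y') ^ numRounds m d := by
  classical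
  let G : Finset (Fin m → Fin (2 ^ (m + 2))) :=
    {u | Reveals (fun k => cellOf (threshold m d) (u k)) d y y'}
  have hset : {ω | ¬Success d y y' ω} = {ω | ∀ ρ : Fin (numRounds m d), (fun k : Fin m =>
      wordEquiv (m + 2) fun l => ω ((ρ * m + k) * (m + 2) + l)) ∈ Gᶜ} := by
    ext ω
    simp only [Set.mem_ofPred_eq, Success, not_exists, not_and, Fin.forall_iff, G,
      Finset.mem_compl, Finset.mem_filter_univ, wordEquiv_block]
    rfl
  rw [hset, fairBits_forall_drawn, Finset.card_compl, Nat.cast_sub (Finset.card_le_univ _)]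
  simp [sub_div, revealProb, G]

theorem revealProb_nonneg : 0 ≤ revealProb d y y' := by unfold revealProb; positivity

theorem revealProb_le_one : revealProb d y y' ≤ 1 := by
  refine div_le_one_of_le₀ ?_ (by positivity)
  exact_mod_cast (Finset.card_le_univ _).trans_eq (by simp)

theorem denom_le_revealProb (hy : hammingDist y y' = d) :
    denom m d ≤ (m + 1) * (revealProb d y y' * (2 ^ (m + 2)) ^ m) := by
  classical
  have hd := hammingDist_le_dim hy
  rw [revealProb, div_mul_cancel₀ _ (by positivity)]
  refine (Nat.cast_le.2 (card_reveals_ge (two_mul_threshold_le m d) hy)).trans ?_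
  push_cast
  gcongr

theorem two_mul_le_revealProb_mul_numRounds (hy : hammingDist y y' = d) :
    2 * ((m : ℝ) + 1) ≤ revealProb d y y' * numRounds m d := by
  have hdenom : (0 : ℝ) < denom m d := Nat.cast_pos.2 (denom_pos (hammingDist_le_dim hy))
  have hrounds : 2 * ((m + 1) * (m + 1)) * (2 ^ (m + 2)) ^ m / denom m d ≤ (numRounds m d : ℝ) := by
    rw [div_le_iff₀ hdenom]
    have := Nat.lt_div_mul_add (a := 2 * ((m + 1) * (m + 1)) * (2 ^ (m + 2)) ^ m)
      (denom_pos (hammingDist_le_dim hy))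
    rw [← add_one_mul] at this
    exact_mod_cast this.le
  calc 2 * ((m : ℝ) + 1)
      = denom m d / ((m + 1) * (2 ^ (m + 2)) ^ m) *
          (2 * ((m + 1) * (m + 1)) * (2 ^ (m + 2)) ^ m / denom m d) := by field_simp
    _ ≤ revealProb d y y' * numRounds m d := by
        have := denom_le_revealProb hy
        gcongr
        · exact revealProb_nonneg
        rw [div_le_iff₀ (by positivity)]
        linarith

theorem one_sub_pow_le {g : ℝ} {k r n : ℕ} (hg : g ≤ 1) (hr : 2 * (k : ℝ) ≤ g * r)
    (hn : 0 < n) (hnk : n ≤ 2 ^ k) : (1 - g) ^ r ≤ 1 / (n : ℝ) ^ 2 := by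
  have hn' : (n : ℝ) ≤ 2 ^ k := by exact_mod_cast hnk
  calc (1 - g) ^ r ≤ Real.exp (-g) ^ r :=
        pow_le_pow_left₀ (sub_nonneg.2 hg) (Real.one_sub_le_exp_neg g) r
    _ = Real.exp (-(g * r)) := by rw [← Real.exp_nat_mul, mul_neg, mul_comm]
    _ ≤ Real.exp (-(2 * k)) := by gcongr
    _ = 1 / (Real.exp 1 ^ k) ^ 2 := by
        rw [← pow_mul, ← Real.exp_nat_mul, Real.exp_neg, one_div, mul_one, mul_comm k]
        push_cast
        rfl
    _ ≤ 1 / (2 ^ k) ^ 2 := by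
        have := Real.exp_one_gt_two.le
        gcongr
    _ ≤ 1 / (n : ℝ) ^ 2 := by gcongr

theorem fairBits_not_success_le (hy : hammingDist y y' = d) (hn : 0 < n) (hnm : n ≤ 2 ^ (m + 1)) :
    fairBits.real {ω | ¬Success d y y' ω} ≤ 1 / (n : ℝ) ^ 2 := by
  rw [fairBits_not_success]
  refine one_sub_pow_le revealProb_le_one ?_ hn hnm
  exact_mod_cast two_mul_le_revealProb_mul_numRounds hy

end failure

/-! ### Entropy and the number of rounds -/

section entropy

variable {m d : ℕ} {p : ℝ}

/-- The probability of fixing a coordinate to `0` that `threshold m d / 2 ^ (m + 2)`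
approximates. -/
noncomputable def fixProb (m d : ℕ) : ℝ := min ((d : ℝ) / m) (1 / 2)

theorem fixProb_nonneg (m d : ℕ) : 0 ≤ fixProb m d := le_min (by positivity) (by norm_num)

theorem fixProb_le_half (m d : ℕ) : fixProb m d ≤ 1 / 2 := min_le_right _ _

theorem exp_mul_log {x : ℝ} {k : ℕ} (h : k ≠ 0 → 0 < x) : Real.exp (k * Real.log x) = x ^ k := by
  obtain rfl | hk := eq_or_ne k 0
  · simp
  · rw [Real.exp_nat_mul, Real.exp_log (h hk)]

theorem two_rpow_entropy2_mul (p x : ℝ) :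
    (2 : ℝ) ^ (entropy2 p * x) =
      Real.exp (-(p * x * Real.log p + (1 - p) * x * Real.log (1 - p))) := by
  have hlog := (Real.log_pos one_lt_two).ne'
  rw [Real.rpow_def_of_pos two_pos, entropy2,
    Real.binEntropy_eq_negMulLog_add_negMulLog_one_sub, Real.negMulLog, Real.negMulLog]
  congr 1
  field_simp
  ring

theorem two_rpow_entropy2_fixProb (hm : 0 < m) (hd : d ≤ m) :
    (2 : ℝ) ^ (entropy2 (fixProb m d) * m) *
      (fixProb m d ^ d * (1 - fixProb m d) ^ (m - d)) = 1 := by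
  have hm' : (0 : ℝ) < m := Nat.cast_pos.2 hm
  have hp := fixProb_le_half m d
  rw [two_rpow_entropy2_mul, ← exp_mul_log (k := d) fun h => ?_,
    ← exp_mul_log (x := 1 - _) fun _ => by linarith, ← Real.exp_add, ← Real.exp_add,
    Real.exp_eq_one_iff, Nat.cast_sub hd]
  · obtain h | h := min_choice ((d : ℝ) / m) (1 / 2) <;> rw [fixProb, h]
    · field_simp
      ring
    · norm_num
      ring
  · exact lt_min (div_pos (Nat.cast_pos.2 (Nat.pos_of_ne_zero h)) hm') (by norm_num)

theorem mul_fixProb_le_threshold (hm : 0 < m) :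
    (2 : ℝ) ^ (m + 2) * fixProb m d ≤ threshold m d := by
  have hm' : (0 : ℝ) < m := Nat.cast_pos.2 hm
  have hceil : 2 ^ (m + 2) * d ≤ m * (2 ^ (m + 2) * d ⌈/⌉ m) := le_smul_ceilDiv hm
  rw [threshold, Nat.cast_min, fixProb, mul_min_of_nonneg _ _ (by positivity)]
  refine min_le_min ?_ ?_
  · rw [mul_div_assoc', div_le_iff₀' hm']
    exact_mod_cast hceil
  · rw [pow_succ _ (m + 1)]
    push_cast
    linarith

theorem threshold_le_mul_fixProb_add_one (hm : 0 < m) :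
    (threshold m d : ℝ) ≤ 2 ^ (m + 2) * fixProb m d + 1 := by
  have hceil : ((2 ^ (m + 2) * d ⌈/⌉ m : ℕ) : ℝ) ≤ 2 ^ (m + 2) * (d / m) + 1 := by
    rw [Nat.ceilDiv_eq_add_pred_div]
    refine Nat.cast_div_le.trans ?_
    rw [div_le_iff₀ (Nat.cast_pos.2 hm), add_mul, one_mul, mul_assoc,
      div_mul_cancel₀ _ (Nat.cast_ne_zero.2 hm.ne')]
    exact_mod_cast Nat.sub_le _ _
  rw [threshold, Nat.cast_min, fixProb, mul_min_of_nonneg _ _ (by positivity),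
    ← min_add_add_right]
  refine min_le_min hceil ?_
  rw [pow_succ _ (m + 1)]
  push_cast
  linarith

theorem half_le_one_sub_pow {P : ℝ} {k : ℕ} (hP : 0 < P) (hmP : 4 * (m : ℝ) ≤ P)
    (hkm : k ≤ m) (h2P : 2 ≤ P) : 1 / 2 ≤ (1 - 2 / P) ^ k := by
  have h1 : 2 / P ≤ 1 := (div_le_one hP).2 h2P
  have hk : (k : ℝ) * (2 / P) ≤ 1 / 2 := by
    have : (k : ℝ) ≤ m := Nat.cast_le.2 hkm
    rw [mul_div_assoc', div_le_iff₀ hP]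
    linarith
  have := one_add_mul_le_pow (a := -(2 / P)) (by linarith) k
  rw [← sub_eq_add_neg] at this
  linarith

/-- Rounding the threshold costs at most the factor `2`. -/
theorem pow_mul_le_denom (hm : 0 < m) (hd : d ≤ m) :
    ((2 : ℝ) ^ (m + 2)) ^ m * (2 ^ d * (fixProb m d ^ d * (1 - fixProb m d) ^ (m - d))) ≤
      2 * denom m d := by
  set p := fixProb m d
  set P : ℝ := 2 ^ (m + 2) with hP
  have hp0 : 0 ≤ p := fixProb_nonneg m d
  have hp : p ≤ 1 / 2 := fixProb_le_half m d
  have hmP : 4 * (m : ℝ) ≤ P := by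
    have : (m : ℝ) ≤ 2 ^ m := by exact_mod_cast Nat.lt_two_pow_self.le
    rw [hP, pow_add]
    linarith
  have h2P : 2 ≤ P := by
    have : (1 : ℝ) ≤ m := Nat.one_le_cast.2 hm
    linarith
  have hP0 : 0 < P := by positivity
  have hsub : 0 ≤ 1 - 2 / P := sub_nonneg.2 ((div_le_one hP0).2 h2P)
  have hfix := mul_fixProb_le_threshold (d := d) hm
  have hfree : P * (1 - p) * (1 - 2 / P) ≤ P - threshold m d := by
    have hround := threshold_le_mul_fixProb_add_one (d := d) hm
    have : P * (1 - p) * (1 - 2 / P) = P - P * p - 2 * (1 - p) := by field_simp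
    linarith
  calc P ^ m * (2 ^ d * (p ^ d * (1 - p) ^ (m - d)))
      ≤ P ^ m * (2 ^ d * (p ^ d * (1 - p) ^ (m - d))) * (2 * (1 - 2 / P) ^ (m - d)) := by
        have : 0 ≤ 1 - p := by linarith
        refine le_mul_of_one_le_right (by positivity) ?_
        have := half_le_one_sub_pow hP0 hmP (Nat.sub_le m d) h2P
        linarith
    _ = 2 * ((2 * (P * p)) ^ d * (P * (1 - p) * (1 - 2 / P)) ^ (m - d)) := by
        rw [← Nat.add_sub_cancel' hd, pow_add P, Nat.add_sub_cancel' hd]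
        simp only [mul_pow]
        ring
    _ ≤ 2 * ((2 * threshold m d) ^ d * (P - threshold m d) ^ (m - d)) := by
        have : 0 ≤ 1 - p := by linarith
        gcongr
    _ = 2 * denom m d := by
        have : threshold m d ≤ 2 ^ (m + 2) := by have := two_mul_threshold_le m d; omega
        rw [denom]
        push_cast [this]
        rfl

/-- The exponential factor in the running time. -/
noncomputable def expFactor (m d : ℕ) : ℝ := 2 ^ ((entropy2 (fixProb m d) - d / m) * m)

theorem expFactor_nonneg (m d : ℕ) : 0 ≤ expFactor m d := Real.rpow_nonneg two_pos.le _

theorem expFactor_mul_two_pow (hm : 0 < m) :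
    expFactor m d * 2 ^ d = 2 ^ (entropy2 (fixProb m d) * m) := by
  have hm' : (m : ℝ) ≠ 0 := Nat.cast_ne_zero.2 hm.ne'
  rw [expFactor, ← Real.rpow_natCast, ← Real.rpow_add two_pos, sub_mul, div_mul_cancel₀ _ hm',
    sub_add_cancel]

theorem pow_le_expFactor_mul_denom (hm : 0 < m) (hd : d ≤ m) :
    ((2 : ℝ) ^ (m + 2)) ^ m ≤ 2 * expFactor m d * denom m d := by
  set q := fixProb m d ^ d * (1 - fixProb m d) ^ (m - d)
  have hentropy : expFactor m d * 2 ^ d * q = 1 := by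
    rw [expFactor_mul_two_pow hm, two_rpow_entropy2_fixProb hm hd]
  calc ((2 : ℝ) ^ (m + 2)) ^ m = expFactor m d * ((2 ^ (m + 2)) ^ m * (2 ^ d * q)) := by
        linear_combination -(2 ^ (m + 2)) ^ m * hentropy
    _ ≤ expFactor m d * (2 * denom m d) :=
        mul_le_mul_of_nonneg_left (pow_mul_le_denom hm hd) (expFactor_nonneg m d)
    _ = 2 * expFactor m d * denom m d := by ring

theorem numRounds_le (hm : 0 < m) (hd : d ≤ m) :
    (numRounds m d : ℝ) ≤ 6 * (m + 1) ^ 2 * expFactor m d := by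
  have hdenom : (0 : ℝ) < denom m d := Nat.cast_pos.2 (denom_pos hd)
  have hpow := pow_le_expFactor_mul_denom hm hd
  have hexp : 1 ≤ 2 * expFactor m d := by
    have hle : (denom m d : ℝ) ≤ (2 ^ (m + 2)) ^ m := by exact_mod_cast denom_le hd
    exact le_of_mul_le_mul_right (by linarith) hdenom
  have hquot : ((2 * ((m + 1) * (m + 1)) * (2 ^ (m + 2)) ^ m / denom m d : ℕ) : ℝ) ≤
      2 * (m + 1) ^ 2 * (2 * expFactor m d) := by
    refine Nat.cast_div_le.trans ?_
    rw [div_le_iff₀ hdenom]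
    push_cast
    linear_combination 2 * ((m : ℝ) + 1) ^ 2 * hpow
  have hone : 1 ≤ ((m : ℝ) + 1) ^ 2 * (2 * expFactor m d) :=
    one_le_mul_of_one_le_of_one_le (one_le_pow₀ (by simp)) hexp
  rw [numRounds, Nat.cast_add, Nat.cast_one]
  linarith

end entropy

/-! ### The algorithm finds the closest pair -/

section algorithm

variable {n m d : ℕ} {x : Fin n → BinWord m} {i j : Fin n} {dec : Option (BinWord m → BinWord m)}

/-- The polynomial factor in the running time. -/
noncomputable def timePoly : Polynomial ℕ := 6300000 * (Polynomial.X + 1) ^ 6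

theorem numSteps_le (hn : 0 < n) : numSteps n m d ≤ numRounds m d * n * (50 * (m + 1) ^ 2) := by
  have hR : 1 ≤ numRounds m d := Nat.le_add_left _ _
  calc numSteps n m d = (9 * m + 26) + numRounds m d * (4 * m ^ 2 + 14 * m + 6)
        + numRounds m d * n * (9 * m + 17) := by unfold numSteps roundSteps; ring
    _ ≤ numRounds m d * n * (9 * m + 26) + numRounds m d * n * (4 * m ^ 2 + 14 * m + 6)
        + numRounds m d * n * (9 * m + 17) := by
        gcongr
        · exact Nat.le_mul_of_pos_left _ (Nat.mul_pos hR hn)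
        · exact Nat.le_mul_of_pos_right _ hn
    _ = numRounds m d * n * (4 * m ^ 2 + 32 * m + 49) := by ring
    _ ≤ numRounds m d * n * (50 * (m + 1) ^ 2) := by gcongr; nlinarith

theorem unitCost_width_le : unitCost (width m) ≤ 21000 * (m + 1) ^ 2 := by
  have hwidth : (m + 5) ^ 2 ≤ (5 * (m + 1)) ^ 2 := Nat.pow_le_pow_left (by omega) 2
  have hone : 1 ≤ (m + 1) ^ 2 := Nat.one_le_pow _ _ m.succ_pos
  rw [mul_pow] at hwidth
  unfold unitCost width maxWeight
  omega

theorem numSteps_mul_unitCost_le (hm : 0 < m) (hd : d ≤ m) (hn : 0 < n) :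
    ((numSteps n m d * unitCost (width m) : ℕ) : ℝ) ≤
      n * expFactor m d * (timePoly.eval m : ℕ) :=
  calc ((numSteps n m d * unitCost (width m) : ℕ) : ℝ)
      ≤ numRounds m d * n * (50 * (m + 1) ^ 2) * (21000 * (m + 1) ^ 2) := by
        exact_mod_cast Nat.mul_le_mul (numSteps_le hn) unitCost_width_le
    _ ≤ 6 * (m + 1) ^ 2 * expFactor m d * n * (50 * (m + 1) ^ 2) * (21000 * (m + 1) ^ 2) := by
        have := numRounds_le hm hd
        gcongr
    _ = n * expFactor m d * (timePoly.eval m : ℕ) := by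
        simp only [timePoly, Polynomial.eval_mul, Polynomial.eval_ofNat, Polynomial.eval_pow,
          Polynomial.eval_add, Polynomial.eval_X, Polynomial.eval_one]
        push_cast
        ring

theorem findsPair_of_lt (h : IsUniqueClosestPair x i j d) (hij : i < j) (hm : 0 < m) :
    FindsPair closestPairProg dec x d i j (n * expFactor m d * (timePoly.eval m : ℕ)) := by
  have hn : 0 < n := two_pos.trans_le h.two_le
  have hrun := exists_exec_closestPairProg dec h hij hm
  refine ⟨fun ω => ?_, ?_⟩
  · obtain ⟨t, f, hexec, ht, -⟩ := hrun ω
    exact ⟨t, f, hexec, (Nat.cast_le.2 ht).trans (numSteps_mul_unitCost_le hm h.le_dim hn)⟩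
  · have hfail := fairBits_not_success_le h.2.1 hn h.card_le
    set found := {ω : ℕ → Bool | ∃ (t : ℕ) (f : State),
      Exec dec closestPairProg (initState x d ω) t f ∧
        s(f.reg 0, f.reg 1) = s((i : ℕ), (j : ℕ))}
    set failed := {ω : ℕ → Bool | ¬Success d (x i) (x j) ω}
    have hcover : found ∪ failed = Set.univ := by
      refine Set.eq_univ_of_forall fun ω => or_iff_not_imp_right.2 fun hω => ?_
      obtain ⟨t, f, hexec, -, hpair⟩ := hrun ω
      exact ⟨t, f, hexec, hpair (not_not.1 hω)⟩
    have hunion := measureReal_union_le (μ := fairBits) found failed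
    rw [hcover, probReal_univ] at hunion
    linarith

theorem findsPair (h : IsUniqueClosestPair x i j d) (hm : 0 < m) :
    FindsPair closestPairProg dec x d i j (n * expFactor m d * (timePoly.eval m : ℕ)) := by
  obtain hij | hij := lt_or_gt_of_ne h.1
  · exact findsPair_of_lt h hij hm
  · have := findsPair_of_lt (dec := dec) h.symm hij hm
    unfold FindsPair at this ⊢
    rwa [Sym2.eq_swap (a := (i : ℕ))]

end algorithm

theorem _root_.RAM.FindsPair.mono {n m d : ℕ} {x : Fin n → BinWord m} {i j : Fin n} {p : Prog}
    {dec : Option (BinWord m → BinWord m)} {T T' : ℝ} (h : FindsPair p dec x d i j T)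
    (hT : T ≤ T') : FindsPair p dec x d i j T' :=
  ⟨fun ω => let ⟨t, f, hexec, ht⟩ := h.1 ω; ⟨t, f, hexec, ht.trans hT⟩, h.2⟩

/-! ### The Zyablov rate -/

section zyablov

variable {δ y : ℝ} {m d : ℕ}

theorem entropy2_nonneg (h0 : 0 ≤ δ) (h1 : δ ≤ 1) : 0 ≤ entropy2 δ :=
  div_nonneg (Real.binEntropy_nonneg h0 h1) (Real.log_nonneg one_le_two)

theorem entropy2_le_one (δ : ℝ) : entropy2 δ ≤ 1 :=
  div_le_one_of_le₀ Real.binEntropy_le_log_two (Real.log_nonneg one_le_two)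

theorem entropy2_zero : entropy2 0 = 0 := by simp [entropy2]

theorem entropy2_half : entropy2 (1 / 2) = 1 := by
  rw [entropy2, one_div, Real.binEntropy_two_inv, div_self (Real.log_pos one_lt_two).ne']

theorem entropy2Inv_spec (h0 : 0 ≤ y) (h1 : y ≤ 1) :
    entropy2Inv y ∈ Set.Icc (0 : ℝ) (1 / 2) ∧ entropy2 (entropy2Inv y) = y := by
  have hcont : ContinuousOn entropy2 (Set.Icc (0 : ℝ) (1 / 2)) :=
    (Real.binEntropy_continuous.div_const _).continuousOn
  have hmem : y ∈ Set.Icc (entropy2 0) (entropy2 (1 / 2)) := by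
    rw [entropy2_zero, entropy2_half]
    exact ⟨h0, h1⟩
  have hpre : ∃ p ∈ Set.Icc (0 : ℝ) (1 / 2), entropy2 p = y :=
    intermediate_value_Icc (by norm_num) hcont hmem
  exact ⟨Function.invFunOn_mem hpre, Function.invFunOn_eq hpre⟩

theorem entropy2Inv_pos (h0 : 0 < y) (h1 : y ≤ 1) : 0 < entropy2Inv y := by
  obtain ⟨⟨hnonneg, -⟩, hinv⟩ := entropy2Inv_spec h0.le h1
  refine hnonneg.lt_of_ne fun h => h0.ne ?_
  rw [← hinv, ← h, entropy2_zero]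

theorem zyablovRate_le (h0 : 0 ≤ δ) (h1 : δ ≤ 1) :
    zyablovRate δ ≤ 1 - entropy2 (min δ (1 / 2)) := by
  refine Real.sSup_le ?_ (sub_nonneg.2 (entropy2_le_one _))
  rintro _ ⟨κ, ⟨hκ0, hκ⟩, rfl⟩
  have hκ1 : κ < 1 := hκ.trans_le (sub_le_self 1 (entropy2_nonneg h0 h1))
  have hpos : 0 < entropy2Inv (1 - κ) := entropy2Inv_pos (by linarith) (by linarith)
  dsimp only
  obtain hδ | hδ := le_total δ (1 / 2)
  · rw [min_eq_left hδ]
    have : 0 ≤ δ / entropy2Inv (1 - κ) := by positivity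
    exact (mul_le_of_le_one_right hκ0.le (by linarith)).trans hκ.le
  · rw [min_eq_right hδ, entropy2_half, sub_self]
    have hle : entropy2Inv (1 - κ) ≤ δ :=
      (entropy2Inv_spec (by linarith) (by linarith)).1.2.trans hδ
    exact mul_nonpos_of_nonneg_of_nonpos hκ0.le (sub_nonpos.2 ((one_le_div hpos).2 hle))

theorem expFactor_le_zyablov (hm : 0 < m) (hd : d ≤ m) :
    expFactor m d ≤ (2 : ℝ) ^ ((1 - zyablovRate ((d : ℝ) / m) - (d : ℝ) / m) * m) := by
  have hδ : (d : ℝ) / m ≤ 1 := div_le_one_of_le₀ (Nat.cast_le.2 hd) (Nat.cast_nonneg m)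
  have := zyablovRate_le (by positivity) hδ
  unfold expFactor fixProb
  gcongr
  · exact one_le_two
  · linarith

end zyablov

/-! ### Codes that meet the Gilbert-Varshamov bound -/

section plotkin

variable {α : Type*} {m d e : ℕ} {C : Finset (BinWord m)}

theorem two_mul_sum_ne_le (C : Finset α) (f : α → Bool) :
    2 * ∑ c ∈ C, ∑ c' ∈ C, (if f c ≠ f c' then 1 else 0) ≤ C.card ^ 2 := by
  set A := (C.filter fun c => f c = true).card
  set B := (C.filter fun c => ¬f c = true).card
  have hAB : A + B = C.card := Finset.card_filter_add_card_filter_not _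
  have hinner (c : α) :
      ∑ c' ∈ C, (if f c ≠ f c' then 1 else 0) = if f c = true then B else A := by
    rw [← Finset.card_filter]
    cases f c <;> simp [A, B]
  calc 2 * ∑ c ∈ C, ∑ c' ∈ C, (if f c ≠ f c' then 1 else 0) = 2 * (A * B + B * A) := by
        simp only [hinner, Finset.sum_ite, Finset.sum_const, smul_eq_mul, A, B]
    _ ≤ (A + B) ^ 2 := by
        have := two_mul_le_add_sq A B
        linarith
    _ = C.card ^ 2 := by rw [hAB]

theorem two_mul_sum_hammingDist_le (C : Finset (BinWord m)) :
    2 * ∑ c ∈ C, ∑ c' ∈ C, hammingDist c c' ≤ m * C.card ^ 2 := by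
  have hswap : ∑ c ∈ C, ∑ c' ∈ C, hammingDist c c' =
      ∑ k : Fin m, ∑ c ∈ C, ∑ c' ∈ C, if c k ≠ c' k then 1 else 0 := by
    simp only [hammingDist, Finset.card_filter, Finset.sum_comm (s := C) (t := Finset.univ)]
  rw [hswap, Finset.mul_sum]
  refine (Finset.sum_le_card_nsmul _ _ _ fun k _ => two_mul_sum_ne_le C fun c => c k).trans_eq ?_
  rw [Finset.card_univ, Fintype.card_fin, smul_eq_mul]

theorem _root_.HasMinDist.le_sum_hammingDist (hC : HasMinDist C e) :
    C.card * ((C.card - 1) * e) ≤ ∑ c ∈ C, ∑ c' ∈ C, hammingDist c c' := by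
  rw [← smul_eq_mul C.card]
  refine Finset.card_nsmul_le_sum _ _ _ fun c hc => ?_
  rw [← Finset.card_erase_of_mem hc, ← smul_eq_mul]
  exact (Finset.card_nsmul_le_sum _ _ _ fun c' hc' => hC c hc c' (Finset.mem_of_mem_erase hc')
    (Finset.ne_of_mem_erase hc').symm).trans (Finset.sum_le_sum_of_subset (Finset.erase_subset _ _))

/-- The Plotkin bound. -/
theorem _root_.HasMinDist.card_le (hC : HasMinDist C e) (he : m < 2 * e) : C.card ≤ 2 * e := by
  by_contra! hcard
  obtain ⟨q, hq⟩ : ∃ q, C.card = q + 1 := Nat.exists_eq_add_one_of_ne_zero (by omega)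
  have hsum : C.card * (2 * ((C.card - 1) * e)) ≤ C.card * (m * C.card) := by
    have := two_mul_sum_hammingDist_le C
    have := hC.le_sum_hammingDist
    linarith
  have hle := Nat.le_of_mul_le_mul_left hsum (by omega)
  rw [hq, Nat.add_sub_cancel] at hle
  nlinarith

theorem entropy2_antitoneOn : AntitoneOn entropy2 (Set.Icc (1 / 2) 1) := fun p hp q hq hpq =>
  div_le_div_of_nonneg_right (Real.binEntropy_strictAntiOn.antitoneOn
    (by rwa [← one_div]) (by rwa [← one_div]) hpq) (Real.log_nonneg one_le_two)

theorem entropy2_succ_div_le (hm : 0 < m) (hd : d ≤ m) (hdm : m < 2 * d) :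
    entropy2 (((d + 1 : ℕ) : ℝ) / m) ≤ entropy2 ((d : ℝ) / m) := by
  have hm' : (0 : ℝ) < m := Nat.cast_pos.2 hm
  have hmem : (d : ℝ) / m ∈ Set.Icc (1 / 2) 1 := by
    refine ⟨?_, div_le_one_of_le₀ (Nat.cast_le.2 hd) hm'.le⟩
    rw [div_le_div_iff₀ two_pos hm', one_mul, mul_comm]
    exact_mod_cast hdm.le
  have hsucc : (d : ℝ) / m ≤ ((d + 1 : ℕ) : ℝ) / m := by
    gcongr
    exact d.le_succ
  obtain h | h := le_or_gt (((d + 1 : ℕ) : ℝ) / m) 1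
  · exact entropy2_antitoneOn hmem ⟨hmem.1.trans hsucc, h⟩ hsucc
  · exact (div_nonpos_of_nonpos_of_nonneg (Real.binEntropy_neg_of_one_lt h).le
      (Real.log_nonneg one_le_two)).trans (entropy2_nonneg (by positivity) hmem.2)

/-- Beyond relative distance `1 / 2` the Plotkin bound makes the code so small that the
Gilbert-Varshamov bound forces `H₂(δ)` up to `1`. -/
theorem expFactor_le_entropy (hm : 0 < m) (hd : d ≤ m) (hC : HasMinDist C (d + 1))
    (hGV : MeetsGV C (d + 1)) :
    expFactor m d ≤
      2 * (m + 1) * (2 : ℝ) ^ ((entropy2 ((d : ℝ) / m) - (d : ℝ) / m) * m) := by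
  set δ : ℝ := d / m with hδ
  obtain hδ2 | hδ2 := le_or_gt δ (1 / 2)
  · rw [expFactor, fixProb, ← hδ, min_eq_left hδ2]
    exact le_mul_of_one_le_left (by positivity) (by linarith [(Nat.cast_nonneg m : (0 : ℝ) ≤ m)])
  have hdm : m < 2 * d := by
    rw [hδ, div_lt_div_iff₀ two_pos (Nat.cast_pos.2 hm), one_mul, mul_comm] at hδ2
    exact_mod_cast hδ2
  have hcard : (C.card : ℝ) ≤ 2 * (m + 1) := by
    exact_mod_cast (hC.card_le (by omega)).trans (by omega)
  have hlarge : (2 : ℝ) ^ ((1 - entropy2 δ) * m) ≤ C.card := by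
    refine le_trans ?_ hGV
    have := entropy2_succ_div_le hm hd hdm
    gcongr
    exact one_le_two
  calc expFactor m d
      = (2 : ℝ) ^ ((1 - entropy2 δ) * m) * (2 : ℝ) ^ ((entropy2 δ - δ) * m) := by
        rw [← Real.rpow_add two_pos, expFactor, fixProb, ← hδ, min_eq_right hδ2.le, entropy2_half]
        ring_nf
    _ ≤ 2 * (m + 1) * (2 : ℝ) ^ ((entropy2 δ - δ) * m) := by
        gcongr
        exact hlarge.trans hcard

end plotkin

theorem le_mul_logb_sq {n : ℕ} (hn : 2 ≤ n) : (n : ℝ) ≤ n * Real.logb 2 n ^ 2 := by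
  refine le_mul_of_one_le_right n.cast_nonneg
    (one_le_pow₀ ((Real.le_logb_iff_rpow_le one_lt_two (by positivity)).2 ?_))
  rw [Real.rpow_one]
  exact_mod_cast hn

section running_time

variable {n m d : ℕ} {P : Polynomial ℕ} {C : Finset (BinWord m)}

theorem time_le_zyablov (hn : 2 ≤ n) (hm : 0 < m) (hd : d ≤ m) :
    n * expFactor m d * (P.eval m : ℕ) ≤ n * Real.logb 2 n ^ 2 *
      (2 : ℝ) ^ ((1 - zyablovRate ((d : ℝ) / m) - (d : ℝ) / m) * m) * (P.eval m : ℕ) :=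
  mul_le_mul_of_nonneg_right (mul_le_mul (le_mul_logb_sq hn) (expFactor_le_zyablov hm hd)
    (expFactor_nonneg m d) (by positivity)) (Nat.cast_nonneg _)

theorem time_le_entropy (hn : 2 ≤ n) (hm : 0 < m) (hd : d ≤ m) (hC : HasMinDist C (d + 1))
    (hGV : MeetsGV C (d + 1)) :
    n * expFactor m d * (P.eval m : ℕ) ≤ n * Real.logb 2 n ^ 2 *
      (2 : ℝ) ^ ((entropy2 ((d : ℝ) / m) - (d : ℝ) / m) * m) *
        ((2 * (Polynomial.X + 1) * P).eval m : ℕ) := by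
  refine (mul_le_mul_of_nonneg_right (mul_le_mul (le_mul_logb_sq hn)
    (expFactor_le_entropy hm hd hC hGV) (expFactor_nonneg m d) (by positivity))
    (Nat.cast_nonneg _)).trans_eq ?_
  simp only [Polynomial.eval_mul, Polynomial.eval_ofNat, Polynomial.eval_add, Polynomial.eval_X,
    Polynomial.eval_one]
  push_cast
  ring

end running_time

end ClosestPair

open ClosestPair

theorem theorem3p1_general :
    ∃ (p : RAM.Prog) (P : Polynomial ℕ), ∀ (n m d : ℕ) (x : Fin n → BinWord m) (i j : Fin n)
      (dec : Option (BinWord m → BinWord m)),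
      0 < m → IsUniqueClosestPair x i j d →
        RAM.FindsPair p dec x d i j
          (n * (2 : ℝ) ^ ((entropy2 (min ((d : ℝ) / m) (1 / 2)) - (d : ℝ) / m) * m) *
            ((P.eval m : ℕ) : ℝ)) :=
  ⟨closestPairProg, timePoly, fun _ _ _ _ _ _ _ hm hx => findsPair hx hm⟩

/-- Part one: a randomized algorithm for the closest pair problem with time
`O(n log² n · 2 ^ ((1 - κ_Z(δ) - δ) m) · poly(m))`, where `δ = d / m`. Part two: the same with time
`O(n log² n · 2 ^ ((H₂(δ) - δ) m) · poly(m))`, given a black-box unique decoder for an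
`(m, K, d + 1)`-code that meets the Gilbert-Varshamov bound. In both parts one program and one
polynomial (which absorbs the constant) serve all inputs. -/
theorem theorem3p1 :
    (∃ (p : RAM.Prog) (P : Polynomial ℕ), ∀ (n m d : ℕ) (x : Fin n → BinWord m) (i j : Fin n),
      0 < m → IsUniqueClosestPair x i j d →
        RAM.FindsPair p none x d i j
          ((n : ℝ) * Real.logb 2 n ^ 2 *
            (2 : ℝ) ^ ((1 - zyablovRate ((d : ℝ) / m) - (d : ℝ) / m) * m) *
            ((P.eval m : ℕ) : ℝ))) ∧
    (∃ (p : RAM.Prog) (P : Polynomial ℕ), ∀ (n m d : ℕ) (x : Fin n → BinWord m) (i j : Fin n)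
      (C : Finset (BinWord m)) (D : BinWord m → BinWord m),
      0 < m → IsUniqueClosestPair x i j d →
      HasMinDist C (d + 1) → MeetsGV C (d + 1) → IsUniqueDecoder C (d + 1) D →
        RAM.FindsPair p (some D) x d i j
          ((n : ℝ) * Real.logb 2 n ^ 2 *
            (2 : ℝ) ^ ((entropy2 ((d : ℝ) / m) - (d : ℝ) / m) * m) *
            ((P.eval m : ℕ) : ℝ))) := by
  obtain ⟨p, P, hp⟩ := theorem3p1_general
  exact ⟨⟨p, P, fun n m d x i j hm hx =>
      (hp n m d x i j none hm hx).mono (time_le_zyablov hx.two_le hm hx.le_dim)⟩,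
    ⟨p, 2 * (Polynomial.X + 1) * P, fun n m d x i j C D hm hx hC hGV _ =>
      (hp n m d x i j (some D) hm hx).mono (time_le_entropy hx.two_le hm hx.le_dim hC hGV)⟩⟩
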